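/- **Model.** Time is slotted, with slots of length $\Delta$. A task is a finite non-empty list $h=(h_1,\dots,h_K)$ of indices of contents from $\{F_1,\dots,F_N\}$ (repetitions allowed), each content having size $\tau$; the contents $F_1,\dots,F_M$ are cached at the mobile device. Tasks are i.i.d. with an arbitrary law such that $\mathbb E[K^2]<\infty$. The transmission data of a task is $D_{ct}=\tau K$ in MEC mode and $D_{lt}=\tau\cdot\#\{n>M: n\in\{h_1,\dots,h_K\}\}$ in local mode. It occupies the MEC server for $N_c=\lceil \tau K W/(f_c\Delta)+D_{ct}/(R\Delta)\rceil$ slots in MEC mode, and the mobile device for $N_l=\lceil \tau K W/(f_l\Delta)+D_{lt}/(R\Delta)\rceil$ slots in local mode. Here $\tau,\Delta,W,f_c,f_l,R>0$. Write $\bar D_{ct},\bar D_{lt},\bar N_c,\bar N_l$ for the expectations. In slot $t=0,1,2,\dots$ a task arrives with probability $\lambda\in(0,1]$, independently of everything else ($A(t)\in\{0,1\}$). A decision $u(t)=(u_l^1,u_l^2,u_c^1,u_c^2)(t)$ is one of $(0,0,0,0)$, $(1,0,0,0)$, $(0,0,1,0)$, $(1,0,0,1)$, $(0,1,1,0)$,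 where $u_l^i=1$ (resp. $u_c^i=1$) starts the $i$-th task of the slot on the mobile device (resp. the MEC server). With $Q(0)=S_l(0)=S_c(0)=0$, $$Q(t+1)=\bigl(Q(t)-u_l^1(t)-u_l^2(t)-u_c^1(t)-u_c^2(t)\bigr)^++A(t),$$ and $S_l(t+1)=N_l^i(t)-1$ if $u_l^i(t)=1$ for some $i$, and $S_l(t+1)=\max(S_l(t)-1,0)$ otherwise; likewise for $S_c$ with $u_c^i,N_c^i$. A decision may start a task only on an idle device ($S_l(t)=0$, resp. $S_c(t)=0$) and may start at most $Q(t)$ tasks; if it starts exactly one task, this is the first one. A policy chooses $u(t)$ (possibly at random) from the past before slot $t$, in particular from $Q,S_l,S_c$ up to time $t$, without knowing the contents of the tasks that have not been started. **Problem P1.** Minimize $$\limsup_{T\to\infty}\frac1{\lambda T}\,\mathbb E\Bigl[\sum_{t=0}^{T-1}\sum_{i=1}^{2}\bigl(u_l^i(t)D_{lt}^i(t)+u_c^i(t)D_{ct}^i(t)\bigr)\Bigr]$$ over the policies with $\limsup_{T\to\infty}\frac1T\mathbb E\bigl[\sum_{t=0}^{T-1}Q(t)\bigr]<\infty$ (the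 feasible ones). Let $\bar D^{Opt}$ be the optimal value, i.e. the infimum. **Proposition.** 1. If $\lambda\le \frac1{\bar N_l}$, then P1 is feasible and $\bar D^{Opt}=\bar D_{lt}$. 2. If $\frac1{\bar N_l}<\lambda<\frac1{\bar N_l}+\frac1{\bar N_c}$, then P1 is feasible and $\bar D^{Opt}=\bar D_{ct}-\frac{1}{\lambda\bar N_l}(\bar D_{ct}-\bar D_{lt})$. 3. If $\lambda=\frac1{\bar N_l}+\frac1{\bar N_c}$, then $\bar D^{Opt}$ is given by the formula of part 2 whenever P1 is feasible; but P1 is infeasible if $\lambda<1$. 4. If $\lambda>\frac1{\bar N_l}+\frac1{\bar N_c}$, then P1 is infeasible. -/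

import Mathlib

open MeasureTheory ProbabilityTheory Filter
open scoped ENNReal unitInterval

noncomputable section

namespace MEC

/-- A task is the vector `[h₁, …, h_K]` of the indices of its contents (with repetitions allowed);
the contents `F₁, …, F_N` are indexed by `Fin N`. -/
abbrev Task (N : ℕ) : Type := List (Fin N)

instance (N : ℕ) : MeasurableSpace (Task N) := ⊤

/-- The parameters of the system. -/
structure System where
  /-- number of contents -/
  N : ℕ
  /-- cache capacity of the mobile device: the first `M` contents are cached -/
  M : ℕ
  /-- size of one content -/
  τ : ℝ
  /-- length of a time slot -/
  Δ : ℝ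
  /-- CPU cycles for one bit -/
  W : ℝ
  /-- CPU frequency of the MEC server -/
  fc : ℝ
  /-- CPU frequency of the mobile device -/
  fl : ℝ
  /-- wireless throughput -/
  R : ℝ
  /-- arrival probability in a slot -/
  lam : I
  /-- the law of a task: arbitrary, subject to the last two fields; in particular the contents may
  be drawn independently from a popularity distribution, with a random number of contents -/
  taskLaw : Measure (Task N)
  τ_pos : 0 < τ
  Δ_pos : 0 < Δ
  W_pos : 0 < W
  fc_pos : 0 < fc
  fl_pos : 0 < fl
  R_pos : 0 < R
  lam_pos : 0 < lam
  isProbabilityMeasure_taskLaw : IsProbabilityMeasure taskLaw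
  /-- a task has at least one content -/
  ae_ne_nil : ∀ᵐ h ∂taskLaw, h ≠ []
  /-- the number of contents of a task has a finite second moment -/
  integrable_sq : Integrable (fun h => (h.length : ℝ) ^ 2) taskLaw

namespace System

variable (sys : System)

/-- The size `D = τ K` of a task. -/
def D (h : Task sys.N) : ℝ := sys.τ * h.length

/-- Indicator of the event that a content is requested by the task and is not cached. -/
def G (h : Task sys.N) (n : Fin sys.N) : ℝ := if sys.M ≤ n.val ∧ n ∈ h then 1 else 0

/-- Transmission data in MEC mode. -/
def Dct (h : Task sys.N) : ℝ := sys.D h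

/-- Computation data in MEC mode. -/
def Dcc (h : Task sys.N) : ℝ := sys.D h

/-- Transmission data in local mode. -/
def Dlt (h : Task sys.N) : ℝ := sys.τ * ∑ n, sys.G h n

/-- Computation data in local mode. -/
def Dlc (h : Task sys.N) : ℝ := sys.D h

/-- Number of slots needed in MEC mode. -/
def Nc (h : Task sys.N) : ℕ :=
  ⌈sys.Dcc h * sys.W / (sys.fc * sys.Δ) + sys.Dct h / (sys.R * sys.Δ)⌉₊

/-- Number of slots needed in local mode. -/
def Nl (h : Task sys.N) : ℕ :=
  ⌈sys.Dlc h * sys.W / (sys.fl * sys.Δ) + sys.Dlt h / (sys.R * sys.Δ)⌉₊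

/-- `E[D_ct]` -/
def meanDct : ℝ := ∫ h, sys.Dct h ∂sys.taskLaw

/-- `E[D_lt]` -/
def meanDlt : ℝ := ∫ h, sys.Dlt h ∂sys.taskLaw

/-- `E[N_c]` -/
def meanNc : ℝ := ∫ h, (sys.Nc h : ℝ) ∂sys.taskLaw

/-- `E[N_l]` -/
def meanNl : ℝ := ∫ h, (sys.Nl h : ℝ) ∂sys.taskLaw

end System

/-- A scheduling decision `(u_l¹, u_l², u_c¹, u_c²)`; there are five of them. -/
inductive Decision
  /-- `(0,0,0,0)` -/
  | none
  /-- `(1,0,0,0)` -/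
  | loc
  /-- `(0,0,1,0)` -/
  | mec
  /-- `(1,0,0,1)` -/
  | locMec
  /-- `(0,1,1,0)` -/
  | mecLoc

instance : MeasurableSpace Decision := ⊤

namespace Decision

/-- The first task of the slot is started on the mobile device. -/
def ul1 : Decision → ℕ
  | loc | locMec => 1
  | _ => 0

/-- The second task of the slot is started on the mobile device. -/
def ul2 : Decision → ℕ
  | mecLoc => 1
  | _ => 0

/-- The first task of the slot is started on the MEC server. -/
def uc1 : Decision → ℕ
  | mec | mecLoc => 1
  | _ => 0

/-- The second task of the slot is started on the MEC server. -/
def uc2 : Decision → ℕ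
  | locMec => 1
  | _ => 0

end Decision

/-- The state `(Q, S_l, S_c)`: the queue length and the numbers of slots during which the mobile
device and the MEC server remain busy. -/
structure State where
  Q : ℕ
  Sl : ℕ
  Sc : ℕ

/-- The decisions that are available in a state. -/
def State.allowed (s : State) : Set Decision :=
  if s.Q = 0 ∨ (s.Sl ≠ 0 ∧ s.Sc ≠ 0) then {.none}
  else if s.Sl ≠ 0 then {.none, .mec}
  else if s.Sc ≠ 0 then {.none, .loc}
  else if s.Q = 1 then {.none, .mec, .loc}
  else Set.univ

/-- What chance supplies in one slot: the number of arrivals `A(t) ∈ {0, 1}`, the first and the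
second task that can be scheduled in this slot, and a uniform variable on which the scheduler
may base a randomized decision. -/
structure Slot (N : ℕ) where
  A : ℕ
  task1 : Task N
  task2 : Task N
  seed : I

/-- A slot as a quadruple. -/
def Slot.toProd {N : ℕ} (x : Slot N) : ℕ × Task N × Task N × I :=
  (x.A, x.task1, x.task2, x.seed)

/-- A quadruple as a slot. -/
def Slot.ofProd {N : ℕ} (x : ℕ × Task N × Task N × I) : Slot N :=
  ⟨x.1, x.2.1, x.2.2.1, x.2.2.2⟩

instance (N : ℕ) : MeasurableSpace (Slot N) := MeasurableSpace.comap Slot.toProd inferInstance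

namespace System

variable (sys : System)

/-- The law of one slot: a Bernoulli arrival, two tasks and a uniform seed, all independent. -/
def slotLaw : Measure (Slot sys.N) :=
  ((bernoulliMeasure (1 : ℕ) 0 sys.lam).prod
    (sys.taskLaw.prod (sys.taskLaw.prod (volume : Measure I)))).map Slot.ofProd

instance : IsProbabilityMeasure sys.slotLaw := by
  have := sys.isProbabilityMeasure_taskLaw
  have h : Measurable (Slot.ofProd (N := sys.N)) :=
    measurable_comap_iff.mpr (measurable_id : Measurable fun x : ℕ × Task sys.N × Task sys.N × I => x)
  exact Measure.isProbabilityMeasure_map h.aemeasurable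

/-- Sample paths. -/
abbrev Path : Type := ℕ → Slot sys.N

/-- The slots are independent and identically distributed. -/
def P : Measure sys.Path := Measure.infinitePi fun _ => sys.slotLaw

/-- What the scheduler may use at time `t`: everything that happened in the slots `0, …, t - 1`
(so in particular `Q`, `S_l`, `S_c` up to time `t`), and the current seed. The contents of tasks
that have not been started are not part of it. -/
@[reducible] def info (t : ℕ) : MeasurableSpace sys.Path :=
  (⨆ s : Fin t, MeasurableSpace.comap (fun ω : sys.Path => ω s) inferInstance) ⊔
    MeasurableSpace.comap (fun ω : sys.Path => (ω t).seed) inferInstance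

/-- One step of the dynamics. -/
def next (s : State) (u : Decision) (x : Slot sys.N) : State where
  Q := s.Q - (u.ul1 + u.ul2 + u.uc1 + u.uc2) + x.A
  Sl := if u.ul1 = 1 then sys.Nl x.task1 - 1
    else if u.ul2 = 1 then sys.Nl x.task2 - 1
    else s.Sl - 1
  Sc := if u.uc1 = 1 then sys.Nc x.task1 - 1
    else if u.uc2 = 1 then sys.Nc x.task2 - 1
    else s.Sc - 1

/-- The state at time `t` under the decisions `π`; the system starts empty. -/
def state (π : ℕ → sys.Path → Decision) (ω : sys.Path) : ℕ → State
  | 0 => ⟨0, 0, 0⟩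
  | t + 1 => sys.next (state π ω t) (π t ω) (ω t)

/-- A scheduling policy: non-anticipating decisions, each available in the current state. -/
structure Policy where
  act : ℕ → sys.Path → Decision
  measurable_act : ∀ t, Measurable[sys.info t] (act t)
  act_mem : ∀ t ω, act t ω ∈ (sys.state act ω t).allowed

variable {sys}

/-- The data transmitted for the tasks that are scheduled in slot `t`. -/
def Policy.data (π : sys.Policy) (t : ℕ) (ω : sys.Path) : ℝ :=
  (π.act t ω).ul1 * sys.Dlt (ω t).task1 + (π.act t ω).uc1 * sys.Dct (ω t).task1 +
    ((π.act t ω).ul2 * sys.Dlt (ω t).task2 + (π.act t ω).uc2 * sys.Dct (ω t).task2)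

/-- The average transmission data per task. -/
def Policy.avgData (π : sys.Policy) : ℝ≥0∞ :=
  limsup (fun T : ℕ => (∫⁻ ω, ENNReal.ofReal (∑ t ∈ Finset.range T, π.data t ω) ∂sys.P) /
    ENNReal.ofReal ((sys.lam : ℝ) * T)) atTop

/-- The average queue length. -/
def Policy.avgQueue (π : sys.Policy) : ℝ≥0∞ :=
  limsup (fun T : ℕ => (∫⁻ ω, ∑ t ∈ Finset.range T, ((sys.state π.act ω t).Q : ℝ≥0∞) ∂sys.P) /
    (T : ℝ≥0∞)) atTop

variable (sys)

/-- The feasible policies: those that satisfy the delay constraint. -/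
def feasible : Set sys.Policy := {π | π.avgQueue < ⊤}

/-- The optimal value: the infimum of the average transmission data per task over the feasible
policies (`⊤` if there is none). -/
def optData : ℝ≥0∞ := ⨅ π ∈ sys.feasible, π.avgData

end System

end MEC

end

/-! Every quantity in P1 is governed by two numbers, the expected numbers of tasks started before
`T` on the mobile device and on the MEC server. A decision is independent of the contents of the
tasks it starts, so the expected data up to `T` is `startsLoc T * meanDlt + startsMec T * meanDct`
(`integral_data`), and conservation of tasks gives `E[Q(T)] = λT - startsLoc T - startsMec T`
(`integral_Q`).

Lower bounds. A device with mean service time `m` starts at most `T/m + o(T)` tasks in expectation.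
The work it starts exceeds `T` at most by the residual service time, whose expectation is `o(T)`
because service times have a second moment (`sum_integral_u_mul_le`, `integral_S_le`). For a
feasible policy `E[Q(T)] ≤ εT` for infinitely many `T` (`frequently_integral_Q_le`), so along these
`T` almost every task has been started. Hence the data per task is at least `meanDlt`, and since at
most `T/meanNl + o(T)` tasks can be local, it is at least the mixed formula. Above the critical rate
the queue grows linearly, so no policy is feasible.

Upper bounds. Each arrival is sent to the mobile device with probability `p` and to the MEC server
otherwise, and each device serves its own queue. Both queues are stable if both loads are less than
one, by a quadratic drift argument (`exists_sum_integral_queue_le`). The choice is `p = 1` in the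
first regime and `p = 1/(λ meanNl)` in the second. The local load may then equal one, so `p` is
approached from below and only the infimum is reached.

Critical rate. Both rate bounds together show that no policy exceeds the formula. For infeasibility,
`Q + S_l/meanNl + S_c/meanNc` is a submartingale; feasibility makes it bounded in L¹, hence almost
surely convergent. Its increments would then tend to zero in probability, but each contains the
arrival, which is independent of the rest of the increment and random if `λ < 1`. -/

noncomputable section

namespace MEC

/-! ### Independence of sigma-algebras and factorization of expectations -/

section Independence

variable {Ω : Type*} {mΩ : MeasurableSpace Ω} {μ : Measure Ω}

/-- If `m₁` is independent of `m₂ ⊔ m₃`, and `m₂` of `m₃`, then `m₁ ⊔ m₂` is independent of `m₃`. -/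
lemma indep_sup_left_of_indep_sup_right [IsProbabilityMeasure μ] {m₁ m₂ m₃ : MeasurableSpace Ω}
    (h₁ : m₁ ≤ mΩ) (h₂ : m₂ ≤ mΩ) (h₃ : m₃ ≤ mΩ)
    (h : Indep m₁ (m₂ ⊔ m₃) μ) (h' : Indep m₂ m₃ μ) : Indep (m₁ ⊔ m₂) m₃ μ := by
  let C : Set (Set Ω) := {s | ∃ a b, MeasurableSet[m₁] a ∧ MeasurableSet[m₂] b ∧ s = a ∩ b}
  have hC : IsPiSystem C := by
    rintro _ ⟨a, b, ha, hb, rfl⟩ _ ⟨a', b', ha', hb', rfl⟩ -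
    exact ⟨a ∩ a', b ∩ b', ha.inter ha', hb.inter hb', Set.inter_inter_inter_comm _ _ _ _⟩
  have hgen : m₁ ⊔ m₂ = MeasurableSpace.generateFrom C := by
    apply le_antisymm
    · refine sup_le (fun a ha => ?_) (fun b hb => ?_)
      · exact MeasurableSpace.measurableSet_generateFrom
          ⟨a, Set.univ, ha, MeasurableSet.univ, by simp⟩
      · exact MeasurableSpace.measurableSet_generateFrom
          ⟨Set.univ, b, MeasurableSet.univ, hb, by simp⟩
    · refine MeasurableSpace.generateFrom_le ?_
      rintro _ ⟨a, b, ha, hb, rfl⟩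
      exact MeasurableSet.inter ((le_sup_left : m₁ ≤ m₁ ⊔ m₂) a ha)
        ((le_sup_right : m₂ ≤ m₁ ⊔ m₂) b hb)
  refine IndepSets.indep (sup_le h₁ h₂) h₃ hC (@MeasurableSpace.isPiSystem_measurableSet _ m₃)
    hgen (@MeasurableSpace.generateFrom_measurableSet _ m₃).symm ?_
  rw [IndepSets_iff]
  rintro _ c ⟨a, b, ha, hb, rfl⟩ hc
  have hc : MeasurableSet[m₃] c := hc
  have hb' := (le_sup_left : m₂ ≤ m₂ ⊔ m₃) b hb
  have hc' := (le_sup_right : m₃ ≤ m₂ ⊔ m₃) c hc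
  rw [Indep_iff] at h h'
  rw [Set.inter_assoc, h a (b ∩ c) ha (MeasurableSet.inter hb' hc'), h' b c hb hc, h a b ha hb',
    mul_assoc]

variable {β : Type*} [mβ : MeasurableSpace β]

lemma integrable_mul_of_indep {m : MeasurableSpace Ω} {X : Ω → ℝ} {Y : Ω → β} {g : β → ℝ}
    (hXY : Indep m (mβ.comap Y) μ) (hX : Measurable[m] X) (hg : Measurable g)
    (hXi : Integrable X μ) (hYi : Integrable (fun ω => g (Y ω)) μ) :
    Integrable (fun ω => X ω * g (Y ω)) μ := by
  have : IndepFun X (fun ω => g (Y ω)) μ := by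
    rw [IndepFun_iff_Indep]
    exact indep_of_indep_of_le hXY hX.comap_le
      (hg.comp (comap_measurable Y)).comap_le
  exact this.integrable_mul hXi hYi

lemma integral_mul_of_indep {m : MeasurableSpace Ω} {X : Ω → ℝ} {Y : Ω → β} {g : β → ℝ}
    (hXY : Indep m (mβ.comap Y) μ) (hX : Measurable[m] X) (hg : Measurable g)
    (hXi : Integrable X μ) (hYi : Integrable (fun ω => g (Y ω)) μ) :
    ∫ ω, X ω * g (Y ω) ∂μ = (∫ ω, X ω ∂μ) * ∫ ω, g (Y ω) ∂μ := by
  have : IndepFun X (fun ω => g (Y ω)) μ := by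
    rw [IndepFun_iff_Indep]
    exact indep_of_indep_of_le hXY hX.comap_le
      (hg.comp (comap_measurable Y)).comap_le
  exact this.integral_fun_mul_eq_mul_integral hXi.1 hYi.1

end Independence

/-! ### A single device: residual service times and the rate of starts -/

section Server

variable {Ω : Type*} {mΩ : MeasurableSpace Ω} {μ : Measure Ω}

/-- A device that serves one task at a time: in slot `t` it starts `u t ≤ 1` tasks, the task that
it may start would last `n t` slots, and it remains busy for `S t` slots. The service times have
the moments `m` and `m₂`, and `n t` is independent of `𝒢 t`, on which the decision `u t` is based. -/
structure Server (μ : Measure Ω) (𝒢 : ℕ → MeasurableSpace Ω) (m m₂ : ℝ) (u n S : ℕ → Ω → ℕ) :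
    Prop where
  le : ∀ t, 𝒢 t ≤ mΩ
  u_le_one : ∀ t ω, u t ω ≤ 1
  idle : ∀ t ω, u t ω = 1 → S t ω = 0
  S_zero : ∀ ω, S 0 ω = 0
  S_succ : ∀ t ω, S (t + 1) ω = if u t ω = 1 then n t ω - 1 else S t ω - 1
  measurable_u : ∀ t, Measurable[𝒢 t] (u t)
  measurable_S : ∀ t, Measurable[𝒢 t] (S t)
  measurable_n : ∀ t, Measurable (n t)
  indep : ∀ t, Indep (𝒢 t) (MeasurableSpace.comap (n t) inferInstance) μ
  integrable_sq : ∀ t, Integrable (fun ω => (n t ω : ℝ) ^ 2) μ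
  integral_n : ∀ t, ∫ ω, (n t ω : ℝ) ∂μ = m
  integral_sq : ∀ t, ∫ ω, (n t ω : ℝ) ^ 2 ∂μ = m₂

namespace Server

variable {𝒢 : ℕ → MeasurableSpace Ω} {m m₂ : ℝ} {u n S : ℕ → Ω → ℕ}

/-- While the device is busy, one slot lowers `S²` by at least `S`, since `k² + (k + 1) ≤ (k + 1)²`;
a start happens at `S = 0` and creates at most `n²`. The sum charges `n²` to every slot, with or
without a start, so that its expectation is simply `T m₂` under any policy. -/
lemma sq_add_sum_le (h : Server μ 𝒢 m m₂ u n S) (T : ℕ) (ω : Ω) :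
    S T ω ^ 2 + ∑ t ∈ Finset.range T, S t ω ≤ ∑ t ∈ Finset.range T, n t ω ^ 2 := by
  induction T with
  | zero => simp [h.S_zero]
  | succ T ih =>
    rw [Finset.sum_range_succ, Finset.sum_range_succ]
    have key : S (T + 1) ω ^ 2 + S T ω ≤ S T ω ^ 2 + n T ω ^ 2 := by
      rw [h.S_succ]
      split_ifs with hu
      · rw [h.idle T ω hu]
        have : (n T ω - 1) ^ 2 ≤ n T ω ^ 2 := Nat.pow_le_pow_left (Nat.sub_le _ _) 2
        omega
      · rcases Nat.eq_zero_or_pos (S T ω) with h0 | h0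
        · simp [h0]
        · obtain ⟨k, hk⟩ := Nat.exists_eq_succ_of_ne_zero h0.ne'
          rw [hk, Nat.succ_sub_one]
          have : k ^ 2 + k.succ ≤ k.succ ^ 2 := by
            rw [Nat.succ_eq_add_one]; nlinarith
          omega
    omega

/-- One slot performs at most one unit of work; the inequality is strict exactly when work is lost
to idleness or to a service time of zero. -/
lemma add_mul_le_succ (h : Server μ 𝒢 m m₂ u n S) (t : ℕ) (ω : Ω) :
    (S t ω : ℝ) + u t ω * n t ω - 1 ≤ S (t + 1) ω := by
  have : S t ω + u t ω * n t ω ≤ S (t + 1) ω + 1 := by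
    rw [h.S_succ]
    split_ifs with hu
    · rw [h.idle t ω hu, hu]; omega
    · have : u t ω = 0 := by have := h.u_le_one t ω; omega
      rw [this]; omega
  have := (Nat.cast_le (α := ℝ)).2 this
  push_cast at this
  linarith

lemma integrable_n (h : Server μ 𝒢 m m₂ u n S) (t : ℕ) : Integrable (fun ω => (n t ω : ℝ)) μ := by
  refine (h.integrable_sq t).mono' ?_ (ae_of_all _ fun ω => ?_)
  · exact (measurable_from_nat.comp (h.measurable_n t)).aestronglyMeasurable
  · rw [Real.norm_of_nonneg (by positivity)]
    exact_mod_cast Nat.le_self_pow two_ne_zero _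

lemma measurable_S_real (h : Server μ 𝒢 m m₂ u n S) (t : ℕ) :
    Measurable[𝒢 t] (fun ω => (S t ω : ℝ)) :=
  measurable_from_nat.comp (h.measurable_S t)

lemma measurable_u_real (h : Server μ 𝒢 m m₂ u n S) (t : ℕ) :
    Measurable[𝒢 t] (fun ω => (u t ω : ℝ)) :=
  measurable_from_nat.comp (h.measurable_u t)

lemma integrable_S_sq (h : Server μ 𝒢 m m₂ u n S) (t : ℕ) :
    Integrable (fun ω => (S t ω : ℝ) ^ 2) μ := by
  refine (integrable_finsetSum (Finset.range t) fun s _ => h.integrable_sq s).mono' ?_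
    (ae_of_all _ fun ω => ?_)
  · exact (((h.measurable_S_real t).mono (h.le t) le_rfl).pow_const 2).aestronglyMeasurable
  · rw [Real.norm_of_nonneg (by positivity)]
    exact_mod_cast le_trans (Nat.le_add_right _ _) (h.sq_add_sum_le t ω)

lemma integrable_S (h : Server μ 𝒢 m m₂ u n S) (t : ℕ) : Integrable (fun ω => (S t ω : ℝ)) μ := by
  refine (h.integrable_S_sq t).mono' ?_ (ae_of_all _ fun ω => ?_)
  · exact ((h.measurable_S_real t).mono (h.le t) le_rfl).aestronglyMeasurable
  · rw [Real.norm_of_nonneg (by positivity)]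
    exact_mod_cast Nat.le_self_pow two_ne_zero _

lemma integrable_u [IsProbabilityMeasure μ] (h : Server μ 𝒢 m m₂ u n S) (t : ℕ) :
    Integrable (fun ω => (u t ω : ℝ)) μ := by
  refine (integrable_const (1 : ℝ)).mono' ?_ (ae_of_all _ fun ω => ?_)
  · exact ((h.measurable_u_real t).mono (h.le t) le_rfl).aestronglyMeasurable
  · rw [Real.norm_of_nonneg (by positivity)]
    exact_mod_cast h.u_le_one t ω

lemma integral_S_sq_add_sum_le (h : Server μ 𝒢 m m₂ u n S) (T : ℕ) :
    ∫ ω, (S T ω : ℝ) ^ 2 ∂μ + ∑ t ∈ Finset.range T, ∫ ω, (S t ω : ℝ) ∂μ ≤ T * m₂ := by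
  calc ∫ ω, (S T ω : ℝ) ^ 2 ∂μ + ∑ t ∈ Finset.range T, ∫ ω, (S t ω : ℝ) ∂μ
      = ∫ ω, ((S T ω : ℝ) ^ 2 + ∑ t ∈ Finset.range T, (S t ω : ℝ)) ∂μ := by
        rw [integral_add (h.integrable_S_sq T)
          (integrable_finsetSum _ fun t _ => h.integrable_S t),
          integral_finsetSum _ fun t _ => h.integrable_S t]
    _ ≤ ∫ ω, ∑ t ∈ Finset.range T, (n t ω : ℝ) ^ 2 ∂μ := by
        refine integral_mono ((h.integrable_S_sq T).add
          (integrable_finsetSum _ fun t _ => h.integrable_S t))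
          (integrable_finsetSum _ fun t _ => h.integrable_sq t) fun ω => ?_
        exact_mod_cast h.sq_add_sum_le T ω
    _ = T * m₂ := by
        rw [integral_finsetSum _ fun t _ => h.integrable_sq t]
        simp [h.integral_sq]

lemma sum_integral_S_le (h : Server μ 𝒢 m m₂ u n S) (T : ℕ) :
    ∑ t ∈ Finset.range T, ∫ ω, (S t ω : ℝ) ∂μ ≤ T * m₂ := by
  have := h.integral_S_sq_add_sum_le T
  have : 0 ≤ ∫ ω, (S T ω : ℝ) ^ 2 ∂μ := integral_nonneg fun ω => by positivity
  linarith

lemma integral_S_sq_le (h : Server μ 𝒢 m m₂ u n S) (T : ℕ) :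
    ∫ ω, (S T ω : ℝ) ^ 2 ∂μ ≤ T * m₂ := by
  have := h.integral_S_sq_add_sum_le T
  have : 0 ≤ ∑ t ∈ Finset.range T, ∫ ω, (S t ω : ℝ) ∂μ :=
    Finset.sum_nonneg fun t _ => integral_nonneg fun ω => by positivity
  linarith

/-- The expected residual service time grows sublinearly. -/
lemma integral_S_le [IsProbabilityMeasure μ] (h : Server μ 𝒢 m m₂ u n S) {δ : ℝ} (hδ : 0 < δ) (T : ℕ) :
    ∫ ω, (S T ω : ℝ) ∂μ ≤ δ * T + m₂ / δ := by
  rcases Nat.eq_zero_or_pos T with rfl | hT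
  · have : 0 ≤ m₂ := by rw [← h.integral_sq 0]; exact integral_nonneg fun ω => by positivity
    simp only [h.S_zero, Nat.cast_zero, integral_zero]; positivity
  have hT' : (0 : ℝ) < T := by exact_mod_cast hT
  -- The residual `S` is compared with `δT` through `S ≤ δT + S²/(δT)`; as `E[S²] ≤ T m₂`, the
  -- second term contributes at most the constant `m₂/δ`.
  have ha : 0 < δ * T := by positivity
  calc ∫ ω, (S T ω : ℝ) ∂μ ≤ ∫ ω, (δ * T + (S T ω : ℝ) ^ 2 * (δ * T)⁻¹) ∂μ := by
        refine integral_mono (h.integrable_S T)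
          ((integrable_const _).add ((h.integrable_S_sq T).mul_const _)) fun ω => ?_
        rw [← div_eq_mul_inv]
        change (S T ω : ℝ) ≤ δ * T + (S T ω : ℝ) ^ 2 / (δ * T)
        rw [← sub_le_iff_le_add', le_div_iff₀ ha]
        nlinarith [sq_nonneg ((S T ω : ℝ) - δ * T)]
    _ = δ * T + (∫ ω, (S T ω : ℝ) ^ 2 ∂μ) / (δ * T) := by
        rw [integral_add (integrable_const _) ((h.integrable_S_sq T).mul_const _),
          integral_const, integral_mul_const, div_eq_mul_inv]
        simp
    _ ≤ δ * T + m₂ / δ := by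
        refine add_le_add_right ?_ _
        rw [div_le_div_iff₀ ha hδ]
        nlinarith [h.integral_S_sq_le T]

lemma integrable_mul_n (h : Server μ 𝒢 m m₂ u n S) {t : ℕ} {X : Ω → ℝ} (hX : Measurable[𝒢 t] X)
    (hXi : Integrable X μ) : Integrable (fun ω => X ω * n t ω) μ :=
  integrable_mul_of_indep (h.indep t) hX measurable_from_nat hXi (h.integrable_n t)

lemma integral_mul_n (h : Server μ 𝒢 m m₂ u n S) {t : ℕ} {X : Ω → ℝ} (hX : Measurable[𝒢 t] X)
    (hXi : Integrable X μ) : ∫ ω, X ω * n t ω ∂μ = (∫ ω, X ω ∂μ) * m := by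
  rw [← h.integral_n t]
  exact integral_mul_of_indep (g := fun k : ℕ => (k : ℝ)) (h.indep t) hX measurable_from_nat hXi
    (h.integrable_n t)

/-- The expected work that is started exceeds the elapsed time at most by the residual work. -/
lemma sum_integral_u_mul_le [IsProbabilityMeasure μ] (h : Server μ 𝒢 m m₂ u n S) (T : ℕ) :
    (∑ t ∈ Finset.range T, ∫ ω, (u t ω : ℝ) ∂μ) * m ≤ T + ∫ ω, (S T ω : ℝ) ∂μ := by
  induction T with
  | zero => simp [h.S_zero]
  | succ T ih =>
    have hi := h.integrable_mul_n (h.measurable_u_real T) (h.integrable_u T)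
    have hi' : Integrable (fun ω => (S T ω : ℝ) + u T ω * n T ω) μ := (h.integrable_S T).add hi
    have key : ∫ ω, (S T ω : ℝ) ∂μ + (∫ ω, (u T ω : ℝ) ∂μ) * m - 1 ≤ ∫ ω, (S (T + 1) ω : ℝ) ∂μ := by
      calc _ = ∫ ω, ((S T ω : ℝ) + u T ω * n T ω - 1) ∂μ := by
            rw [integral_sub hi' (integrable_const _),
              integral_add (h.integrable_S T) hi,
              h.integral_mul_n (h.measurable_u_real T) (h.integrable_u T)]
            simp
        _ ≤ _ := integral_mono (hi'.sub (integrable_const _))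
            (h.integrable_S (T + 1)) (h.add_mul_le_succ T)
    rw [Finset.sum_range_succ, add_mul]
    push_cast
    linarith

lemma sum_integral_u_mul_le_of_pos [IsProbabilityMeasure μ] (h : Server μ 𝒢 m m₂ u n S) {δ : ℝ} (hδ : 0 < δ) (T : ℕ) :
    (∑ t ∈ Finset.range T, ∫ ω, (u t ω : ℝ) ∂μ) * m ≤ (1 + δ) * T + m₂ / δ := by
  have := h.sum_integral_u_mul_le T
  have := h.integral_S_le hδ T
  linarith

/-! ### Stability of a single-server queue by a quadratic drift -/

section Queue

variable {ℱ : ℕ → MeasurableSpace Ω} {q a : ℕ → Ω → ℕ} {r r₂ : ℝ}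

lemma integrable_queue_sq (hle : ∀ t, ℱ t ≤ mΩ) (q_zero : ∀ ω, q 0 ω = 0)
    (q_succ : ∀ t ω, q (t + 1) ω = q t ω - u t ω + a t ω)
    (measurable_q : ∀ t, Measurable[ℱ t] (q t))
    (integrable_a_sq : ∀ t, Integrable (fun ω => (a t ω : ℝ) ^ 2) μ) (t : ℕ) :
    Integrable (fun ω => (q t ω : ℝ) ^ 2) μ := by
  induction t with
  | zero => simp [q_zero]
  | succ t ih =>
    refine ((ih.const_mul 2).add ((integrable_a_sq t).const_mul 2)).mono' ?_
      (ae_of_all _ fun ω => ?_)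
    · exact ((measurable_from_nat.comp ((measurable_q (t + 1)).mono (hle _) le_rfl)).pow_const
        2).aestronglyMeasurable
    · rw [Real.norm_of_nonneg (by positivity)]
      have h1 : q (t + 1) ω ≤ q t ω + a t ω := by rw [q_succ]; omega
      have h1 : (q (t + 1) ω : ℝ) ≤ q t ω + a t ω := by exact_mod_cast h1
      have h0 : (0 : ℝ) ≤ q (t + 1) ω := by positivity
      simp only [Pi.add_apply]
      nlinarith [sq_nonneg ((q t ω : ℝ) - a t ω)]

/-- The one-step bound for the square of the workload `m q + S`. -/
lemma workload_sq_le (h : Server μ 𝒢 m m₂ u n S) (hm : 0 ≤ m)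
    (q_succ : ∀ t ω, q (t + 1) ω = q t ω - u t ω + a t ω)
    (hu : ∀ t ω, u t ω = if S t ω = 0 ∧ 0 < q t ω then 1 else 0) {t : ℕ} {ω : Ω}
    (hn : 1 ≤ n t ω) :
    (m * q (t + 1) ω + S (t + 1) ω) ^ 2 + 2 * (m * q t ω + S t ω) ≤
      (m * q t ω + S t ω) ^ 2 + 2 * m * ((m * q t ω + S t ω) * a t ω) +
        2 * ((m * q t ω + S t ω) * u t ω * n t ω) - 2 * m * ((m * q t ω + S t ω) * u t ω) +
        (3 * m ^ 2 * (a t ω : ℝ) ^ 2 + 6 * (n t ω : ℝ) ^ 2 + (6 * m ^ 2 + 3)) := by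
  set V : ℝ := m * q t ω + S t ω with hV
  have hV0 : 0 ≤ V := by positivity
  -- Here `w` is the work done in the slot. It is zero only if the device is idle with an empty
  -- queue, and then `V = 0`, so `V * w = V` in all cases: this is the negative drift. A start
  -- leaves `S = n - 1`, so its first unit of work is counted in the slot itself; `1 ≤ n` keeps the
  -- subtraction honest.
  obtain ⟨w, hw, hw', hu', hstep⟩ : ∃ w : ℝ, V * w = V ∧ w ^ 2 ≤ 1 ∧ (u t ω : ℝ) ^ 2 ≤ 1 ∧
      m * q (t + 1) ω + S (t + 1) ω = V + (m * a t ω + u t ω * (n t ω - m) - w) := by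
    by_cases hst : S t ω = 0 ∧ 0 < q t ω
    · have hu1 : u t ω = 1 := by rw [hu, if_pos hst]
      have hq : ((q t ω - 1 : ℕ) : ℝ) = q t ω - 1 := by rw [Nat.cast_sub hst.2]; simp
      have hn' : ((n t ω - 1 : ℕ) : ℝ) = n t ω - 1 := by rw [Nat.cast_sub hn]; simp
      refine ⟨1, by ring, by norm_num, by simp [hu1], ?_⟩
      rw [q_succ, h.S_succ, if_pos hu1, hu1, Nat.cast_add, hq, hn', hV, hst.1]
      push_cast
      ring
    · have hu0 : u t ω = 0 := by rw [hu, if_neg hst]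
      by_cases hS : S t ω = 0
      · have hq : q t ω = 0 := by by_contra hq; exact hst ⟨hS, Nat.pos_of_ne_zero hq⟩
        refine ⟨0, by simp [hV, hS, hq], by norm_num, by simp [hu0], ?_⟩
        rw [q_succ, h.S_succ, hu0, hV, hS, hq]
        simp
      · have hS' : ((S t ω - 1 : ℕ) : ℝ) = S t ω - 1 := by
          rw [Nat.cast_sub (Nat.one_le_iff_ne_zero.2 hS)]; simp
        refine ⟨1, by ring, by norm_num, by simp [hu0], ?_⟩
        rw [q_succ, h.S_succ, hu0, if_neg (by norm_num), hS', hV, Nat.sub_zero]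
        push_cast
        ring
  rw [hstep]
  set x := (u t ω : ℝ)
  set y := (n t ω : ℝ)
  set z := (a t ω : ℝ)
  have h1 : (m * z + x * (y - m) - w) ^ 2 ≤
      3 * (m * z) ^ 2 + 3 * (x * (y - m)) ^ 2 + 3 * w ^ 2 := by
    nlinarith [sq_nonneg (m * z - x * (y - m)), sq_nonneg (m * z + w),
      sq_nonneg (x * (y - m) + w)]
  have h2 : (x * (y - m)) ^ 2 ≤ (y - m) ^ 2 := by
    rw [mul_pow]; exact mul_le_of_le_one_left (sq_nonneg _) hu'
  have h3 : (y - m) ^ 2 ≤ 2 * y ^ 2 + 2 * m ^ 2 := by nlinarith [sq_nonneg (y + m)]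
  have h4 : (V + (m * z + x * (y - m) - w)) ^ 2 = V ^ 2 + 2 * m * (V * z) + 2 * (V * x * y) -
      2 * m * (V * x) - 2 * (V * w) + (m * z + x * (y - m) - w) ^ 2 := by ring
  rw [h4, hw]
  nlinarith

/-- A queue with load less than one that is served whenever possible has a bounded time average. -/
lemma exists_sum_integral_queue_le [IsProbabilityMeasure μ] (h : Server μ 𝒢 m m₂ u n S) (hm : 0 < m)
    (hℱ : ∀ t, ℱ t ≤ 𝒢 t) (q_zero : ∀ ω, q 0 ω = 0)
    (q_succ : ∀ t ω, q (t + 1) ω = q t ω - u t ω + a t ω)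
    (hu : ∀ t ω, u t ω = if S t ω = 0 ∧ 0 < q t ω then 1 else 0)
    (measurable_q : ∀ t, Measurable[ℱ t] (q t)) (measurable_S : ∀ t, Measurable[ℱ t] (S t))
    (indep_a : ∀ t, Indep (ℱ t) (MeasurableSpace.comap (a t) inferInstance) μ)
    (integrable_a : ∀ t, Integrable (fun ω => (a t ω : ℝ)) μ)
    (integrable_a_sq : ∀ t, Integrable (fun ω => (a t ω : ℝ) ^ 2) μ)
    (integral_a : ∀ t, ∫ ω, (a t ω : ℝ) ∂μ = r) (integral_a_sq : ∀ t, ∫ ω, (a t ω : ℝ) ^ 2 ∂μ = r₂)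
    (hn : ∀ t, ∀ᵐ ω ∂μ, 1 ≤ n t ω) (hr : r * m < 1) :
    ∃ C : ℝ, ∀ T : ℕ, ∑ t ∈ Finset.range T, ∫ ω, (q t ω : ℝ) ∂μ ≤ C * T := by
  have hle : ∀ t, ℱ t ≤ mΩ := fun t => (hℱ t).trans (h.le t)
  let V : ℕ → Ω → ℝ := fun t ω => m * q t ω + S t ω
  have hVm : ∀ t, Measurable[ℱ t] (V t) := fun t => by
    have h1 : Measurable[ℱ t] (fun ω => (q t ω : ℝ)) := measurable_from_nat.comp (measurable_q t)
    have h2 : Measurable[ℱ t] (fun ω => (S t ω : ℝ)) := measurable_from_nat.comp (measurable_S t)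
    exact (h1.const_mul m).add h2
  have hq2 := integrable_queue_sq (μ := μ) hle q_zero q_succ measurable_q integrable_a_sq
  have hV2 : ∀ t, Integrable (fun ω => V t ω ^ 2) μ := fun t => by
    refine (((hq2 t).const_mul (2 * m ^ 2)).add ((h.integrable_S_sq t).const_mul 2)).mono'
      (((hVm t).mono (hle t) le_rfl).pow_const 2).aestronglyMeasurable (ae_of_all _ fun ω => ?_)
    rw [Real.norm_of_nonneg (by positivity)]
    simp only [Pi.add_apply, V]
    nlinarith [sq_nonneg (m * (q t ω : ℝ) - S t ω)]
  have hVi : ∀ t, Integrable (V t) μ := fun t => by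
    refine ((hV2 t).add (integrable_const 1)).mono'
      ((hVm t).mono (hle t) le_rfl).aestronglyMeasurable (ae_of_all _ fun ω => ?_)
    have : 0 ≤ V t ω := by positivity
    rw [Real.norm_of_nonneg this]
    simp only [Pi.add_apply]
    nlinarith [sq_nonneg (V t ω - 1)]
  have hVu : ∀ t, Integrable (fun ω => V t ω * u t ω) μ := fun t => by
    refine (hVi t).mono' (((hVm t).mono (hle t) le_rfl).mul
      ((h.measurable_u_real t).mono (h.le t) le_rfl)).aestronglyMeasurable
      (ae_of_all _ fun ω => ?_)
    have : 0 ≤ V t ω := by positivity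
    rw [Real.norm_of_nonneg (by positivity)]
    exact mul_le_of_le_one_right this (by exact_mod_cast h.u_le_one t ω)
  have hVum : ∀ t, Measurable[𝒢 t] (fun ω => V t ω * u t ω) := fun t =>
    ((hVm t).mono (hℱ t) le_rfl).mul (h.measurable_u_real t)
  -- Arrivals are required to be independent of `ℱ` only, over which `V` is measurable. The larger
  -- `𝒢` may contain the seed, on which split arrivals depend.
  have hVa : ∀ t, Integrable (fun ω => V t ω * a t ω) μ := fun t =>
    integrable_mul_of_indep (indep_a t) (hVm t) measurable_from_nat (hVi t) (integrable_a t)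
  have hVa' : ∀ t, ∫ ω, V t ω * a t ω ∂μ = (∫ ω, V t ω ∂μ) * r := fun t => by
    rw [← integral_a t]
    exact integral_mul_of_indep (g := fun k : ℕ => (k : ℝ)) (indep_a t) (hVm t)
      measurable_from_nat (hVi t) (integrable_a t)
  set K : ℝ := 3 * m ^ 2 * r₂ + 6 * m₂ + (6 * m ^ 2 + 3) with hK
  -- The two terms with `V u` cancel in expectation, because `n` has mean `m` and is independent of
  -- `𝒢`. The arrival term becomes `2 r m E[V]`, against the `2 E[V]` of work done.
  have hdrift : ∀ t, ∫ ω, V (t + 1) ω ^ 2 ∂μ + 2 * (1 - r * m) * ∫ ω, V t ω ∂μ ≤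
      ∫ ω, V t ω ^ 2 ∂μ + K := fun t => by
    have hVun := h.integrable_mul_n (hVum t) (hVu t)
    have i1 : Integrable (fun ω => V (t + 1) ω ^ 2 + 2 * V t ω) μ :=
      (hV2 (t + 1)).add ((hVi t).const_mul 2)
    have j1 : Integrable (fun ω => V t ω ^ 2 + 2 * m * (V t ω * a t ω)) μ :=
      (hV2 t).add ((hVa t).const_mul _)
    have j2 : Integrable (fun ω => V t ω ^ 2 + 2 * m * (V t ω * a t ω) +
        2 * (V t ω * u t ω * n t ω)) μ := j1.add (hVun.const_mul 2)
    have j3 : Integrable (fun ω => V t ω ^ 2 + 2 * m * (V t ω * a t ω) +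
        2 * (V t ω * u t ω * n t ω) - 2 * m * (V t ω * u t ω)) μ := j2.sub ((hVu t).const_mul _)
    have k1 : Integrable (fun ω => 3 * m ^ 2 * (a t ω : ℝ) ^ 2 + 6 * (n t ω : ℝ) ^ 2) μ :=
      ((integrable_a_sq t).const_mul _).add ((h.integrable_sq t).const_mul _)
    have k2 : Integrable (fun ω => 3 * m ^ 2 * (a t ω : ℝ) ^ 2 + 6 * (n t ω : ℝ) ^ 2 +
        (6 * m ^ 2 + 3)) μ := k1.add (integrable_const _)
    have key := integral_mono_ae i1 (j3.add k2)
      ((hn t).mono fun ω hω => h.workload_sq_le hm.le q_succ hu hω)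
    simp only [Pi.add_apply] at key
    rw [integral_add (hV2 (t + 1)) ((hVi t).const_mul 2), integral_add j3 k2,
      integral_sub j2 ((hVu t).const_mul _), integral_add j1 (hVun.const_mul 2),
      integral_add (hV2 t) ((hVa t).const_mul _), integral_add k1 (integrable_const _),
      integral_add ((integrable_a_sq t).const_mul _) ((h.integrable_sq t).const_mul _)] at key
    simp only [integral_const_mul, h.integral_mul_n (hVum t) (hVu t), hVa', integral_a_sq,
      h.integral_sq, integral_const, probReal_univ, one_smul] at key
    linarith
  have hsum : ∀ T : ℕ, ∫ ω, V T ω ^ 2 ∂μ +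
      2 * (1 - r * m) * ∑ t ∈ Finset.range T, ∫ ω, V t ω ∂μ ≤ K * T := fun T => by
    induction T with
    | zero => simp [V, q_zero, h.S_zero]
    | succ T ih =>
      rw [Finset.sum_range_succ]
      push_cast
      linarith [hdrift T]
  have hpos : 0 < 2 * (1 - r * m) * m := by nlinarith
  refine ⟨K / (2 * (1 - r * m) * m), fun T => ?_⟩
  rw [div_mul_eq_mul_div, le_div_iff₀ hpos]
  have hqV : ∀ t, m * ∫ ω, (q t ω : ℝ) ∂μ ≤ ∫ ω, V t ω ∂μ := fun t => by
    have hqi : Integrable (fun ω => (q t ω : ℝ)) μ := by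
      refine (hq2 t).mono' ?_ (ae_of_all _ fun ω => ?_)
      · exact (measurable_from_nat.comp
          ((measurable_q t).mono (hle _) le_rfl)).aestronglyMeasurable
      · rw [Real.norm_of_nonneg (by positivity)]
        exact_mod_cast Nat.le_self_pow two_ne_zero _
    rw [← integral_const_mul]
    exact integral_mono (hqi.const_mul m) (hVi t) fun ω => by simp [V]
  have h1 : m * ∑ t ∈ Finset.range T, ∫ ω, (q t ω : ℝ) ∂μ ≤
      ∑ t ∈ Finset.range T, ∫ ω, V t ω ∂μ := by
    rw [Finset.mul_sum]
    exact Finset.sum_le_sum fun t _ => hqV t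
  have h2 : 0 ≤ ∫ ω, V T ω ^ 2 ∂μ := integral_nonneg fun ω => by positivity
  have h3 := hsum T
  have h4 : 0 < 1 - r * m := by linarith
  nlinarith

end Queue

end Server

end Server

/-! ### The law of one slot and the independence of its components -/

section Slot

variable {N : ℕ}

lemma Slot.measurable_toProd : Measurable (Slot.toProd (N := N)) := comap_measurable _

lemma Slot.measurable_ofProd : Measurable (Slot.ofProd (N := N)) :=
  measurable_comap_iff.mpr (measurable_id : Measurable fun x : ℕ × Task N × Task N × I => x)

lemma Slot.measurable_A : Measurable (Slot.A (N := N)) := measurable_fst.comp measurable_toProd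

/-- The two tasks of a slot and the seed. -/
def Slot.rest (x : Slot N) : Task N × Task N × I := x.toProd.2

lemma Slot.measurable_rest : Measurable (Slot.rest (N := N)) :=
  measurable_snd.comp measurable_toProd

lemma Slot.measurable_task1 : Measurable (Slot.task1 (N := N)) :=
  measurable_fst.comp measurable_rest

lemma Slot.measurable_task2 : Measurable (Slot.task2 (N := N)) :=
  measurable_fst.comp (measurable_snd.comp measurable_rest)

lemma Slot.measurable_seed : Measurable (Slot.seed (N := N)) :=
  measurable_snd.comp (measurable_snd.comp measurable_rest)

end Slot

namespace System

variable (sys : System)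

instance : IsProbabilityMeasure sys.taskLaw := sys.isProbabilityMeasure_taskLaw

instance : IsProbabilityMeasure sys.P := by unfold P; infer_instance

lemma slotLaw_A_rest {a : Set ℕ} {r : Set (Task sys.N × Task sys.N × I)} (hr : MeasurableSet r) :
    sys.slotLaw (Slot.A ⁻¹' a ∩ Slot.rest ⁻¹' r) = bernoulliMeasure (1 : ℕ) 0 sys.lam a *
      (sys.taskLaw.prod (sys.taskLaw.prod (volume : Measure I))) r := by
  rw [slotLaw, Measure.map_apply Slot.measurable_ofProd
    ((Slot.measurable_A (MeasurableSet.of_discrete)).inter (Slot.measurable_rest hr)),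
    ← Measure.prod_prod]
  rfl

lemma slotLaw_rect (a : Set ℕ) (b c : Set (Task sys.N)) {d : Set I} (hd : MeasurableSet d) :
    sys.slotLaw (Slot.A ⁻¹' a ∩ (Slot.task1 ⁻¹' b ∩ (Slot.task2 ⁻¹' c ∩ Slot.seed ⁻¹' d))) =
      bernoulliMeasure (1 : ℕ) 0 sys.lam a *
        (sys.taskLaw b * (sys.taskLaw c * volume d)) := by
  have hb : MeasurableSet b := trivial
  have hc : MeasurableSet c := trivial
  rw [← Measure.prod_prod, ← Measure.prod_prod, ← slotLaw_A_rest _ (hb.prod (hc.prod hd))]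
  rfl

lemma indepFun_A_rest : IndepFun Slot.A Slot.rest sys.slotLaw := by
  rw [indepFun_iff_measure_inter_preimage_eq_mul]
  intro a r _ hr
  have h1 := sys.slotLaw_A_rest (a := a) hr
  have h2 := sys.slotLaw_A_rest (a := a) (r := Set.univ) MeasurableSet.univ
  have h3 := sys.slotLaw_A_rest (a := Set.univ) hr
  simp only [Set.preimage_univ, Set.inter_univ, Set.univ_inter, measure_univ, mul_one,
    one_mul] at h2 h3
  rw [h1, h2, h3]

lemma slotLaw_A (a : Set ℕ) :
    sys.slotLaw (Slot.A ⁻¹' a) = bernoulliMeasure (1 : ℕ) 0 sys.lam a := by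
  simpa using sys.slotLaw_rect a Set.univ Set.univ MeasurableSet.univ

lemma slotLaw_task1 (b : Set (Task sys.N)) : sys.slotLaw (Slot.task1 ⁻¹' b) = sys.taskLaw b := by
  simpa using sys.slotLaw_rect Set.univ b Set.univ MeasurableSet.univ

lemma slotLaw_task2 (c : Set (Task sys.N)) : sys.slotLaw (Slot.task2 ⁻¹' c) = sys.taskLaw c := by
  simpa using sys.slotLaw_rect Set.univ Set.univ c MeasurableSet.univ

lemma slotLaw_seed {d : Set I} (hd : MeasurableSet d) :
    sys.slotLaw (Slot.seed ⁻¹' d) = volume d := by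
  simpa using sys.slotLaw_rect Set.univ Set.univ Set.univ hd

lemma indepFun_seed_task1 : IndepFun Slot.seed Slot.task1 sys.slotLaw := by
  rw [indepFun_iff_measure_inter_preimage_eq_mul]
  intro d b hd _
  have h := sys.slotLaw_rect Set.univ b Set.univ hd
  simp only [Set.preimage_univ, Set.univ_inter, measure_univ, one_mul] at h
  rw [Set.inter_comm, h, slotLaw_task1, slotLaw_seed _ hd, mul_comm]

lemma indepFun_seed_task2 : IndepFun Slot.seed Slot.task2 sys.slotLaw := by
  rw [indepFun_iff_measure_inter_preimage_eq_mul]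
  intro d c hd _
  have h := sys.slotLaw_rect Set.univ Set.univ c hd
  simp only [Set.preimage_univ, Set.univ_inter, measure_univ, one_mul] at h
  rw [Set.inter_comm, h, slotLaw_task2, slotLaw_seed _ hd, mul_comm]

lemma indepFun_seed_A : IndepFun Slot.A Slot.seed sys.slotLaw :=
  sys.indepFun_A_rest.comp (φ := id) (ψ := fun z : Task sys.N × Task sys.N × I => z.2.2)
    measurable_id (measurable_snd.comp measurable_snd)

lemma ae_A_le_one : ∀ᵐ x ∂sys.slotLaw, x.A ≤ 1 := by
  have h := sys.slotLaw_A {k | ¬ k ≤ 1}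
  rw [bernoulliMeasure_apply_of_notMem_of_notMem _ MeasurableSet.of_discrete (by simp)
    (by simp)] at h
  exact h

lemma integral_A : ∫ x, (x.A : ℝ) ∂sys.slotLaw = sys.lam := by
  have hmap : sys.slotLaw.map Slot.A = bernoulliMeasure (1 : ℕ) 0 sys.lam :=
    Measure.ext fun a ha => by rw [Measure.map_apply Slot.measurable_A ha, slotLaw_A]
  have h : ∫ x, (x.A : ℝ) ∂sys.slotLaw = ∫ k : ℕ, (k : ℝ) ∂(sys.slotLaw.map Slot.A) :=
    (integral_map Slot.measurable_A.aemeasurable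
      measurable_from_nat.aestronglyMeasurable).symm
  rw [h, hmap, integral_bernoulliMeasure]
  simp

/-! ### The past, the information of the scheduler, and independence along a path -/

/-- The sigma-algebra of the slots before `t`. -/
@[reducible] def past (t : ℕ) : MeasurableSpace sys.Path :=
  ⨆ s : Fin t, MeasurableSpace.comap (fun ω : sys.Path => ω s) inferInstance

lemma past_le_info (t : ℕ) : sys.past t ≤ sys.info t := le_sup_left

lemma past_le (t : ℕ) : sys.past t ≤ MeasurableSpace.pi :=
  iSup_le fun s => (measurable_pi_apply (s : ℕ)).comap_le

lemma info_le (t : ℕ) : sys.info t ≤ MeasurableSpace.pi :=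
  sup_le (sys.past_le t) (Measurable.comap_le
    (Slot.measurable_seed.comp (measurable_pi_apply t) : Measurable fun ω : sys.Path => (ω t).seed))

lemma comap_le_past {s t : ℕ} (h : s < t) :
    MeasurableSpace.comap (fun ω : sys.Path => ω s) inferInstance ≤ sys.past t :=
  le_iSup (fun s : Fin t => MeasurableSpace.comap (fun ω : sys.Path => ω s) inferInstance) ⟨s, h⟩

lemma past_mono {s t : ℕ} (h : s ≤ t) : sys.past s ≤ sys.past t :=
  iSup_le fun r => sys.comap_le_past (r.2.trans_le h)

lemma info_le_past {s t : ℕ} (h : s < t) : sys.info s ≤ sys.past t :=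
  sup_le (sys.past_mono h.le) ((Slot.measurable_seed.comp (comap_measurable
    (fun ω : sys.Path => ω s))).comap_le.trans (sys.comap_le_past h))

/-- The sigma-algebra on the right knows everything through slot `t` except the arrival `A(t)`. It
is the one from which the arrival is independent in the critical case. -/
lemma info_le_past_sup_rest (t : ℕ) : sys.info t ≤
    sys.past t ⊔ MeasurableSpace.comap (fun ω : sys.Path => (ω t).rest) inferInstance :=
  sup_le_sup_left (Measurable.comap_le (((measurable_snd.comp measurable_snd).comp
    (comap_measurable fun ω : sys.Path => (ω t).rest)))) _

lemma past_sup_rest_le (t : ℕ) :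
    sys.past t ⊔ MeasurableSpace.comap (fun ω : sys.Path => (ω t).rest) inferInstance ≤
      sys.past (t + 1) :=
  sup_le (sys.past_mono t.le_succ) ((Slot.measurable_rest.comp (comap_measurable
    fun ω : sys.Path => ω t)).comap_le.trans (sys.comap_le_past t.lt_succ_self))

lemma measurePreserving_eval (t : ℕ) :
    MeasurePreserving (fun ω : sys.Path => ω t) sys.P sys.slotLaw :=
  measurePreserving_eval_infinitePi _ t

lemma indep_past_slot (t : ℕ) :
    Indep (sys.past t) (MeasurableSpace.comap (fun ω : sys.Path => ω t) inferInstance) sys.P := by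
  have hind : iIndepFun (fun (s : ℕ) (ω : sys.Path) => ω s) sys.P :=
    iIndepFun_infinitePi (X := fun _ x => x) (fun _ => measurable_id)
  have h := indep_iSup_of_disjoint (S := Set.Iio t) (T := {t})
    (fun s => (measurable_pi_apply s : Measurable fun ω : sys.Path => ω s).comap_le) hind (by simp)
  refine indep_of_indep_of_le h ?_ ?_
  · exact iSup_le fun s => le_iSup₂_of_le (s : ℕ) s.2 le_rfl
  · exact le_iSup₂_of_le t rfl le_rfl

variable {sys}

lemma indep_comap_comap {β γ : Type*} [mβ : MeasurableSpace β] [mγ : MeasurableSpace γ]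
    {f : Slot sys.N → β} {g : Slot sys.N → γ} (hfg : IndepFun f g sys.slotLaw) (hf : Measurable f)
    (hg : Measurable g) (t : ℕ) :
    Indep (mβ.comap fun ω : sys.Path => f (ω t)) (mγ.comap fun ω : sys.Path => g (ω t)) sys.P := by
  rw [← IndepFun_iff_Indep, indepFun_iff_measure_inter_preimage_eq_mul]
  rw [indepFun_iff_measure_inter_preimage_eq_mul] at hfg
  intro s r hs hr
  have he := sys.measurePreserving_eval t
  rw [show (fun ω : sys.Path => f (ω t)) ⁻¹' s = (fun ω : sys.Path => ω t) ⁻¹' (f ⁻¹' s) from rfl,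
    show (fun ω : sys.Path => g (ω t)) ⁻¹' r = (fun ω : sys.Path => ω t) ⁻¹' (g ⁻¹' r) from rfl,
    ← Set.preimage_inter, he.measure_preimage (hf hs).nullMeasurableSet,
    he.measure_preimage (hg hr).nullMeasurableSet,
    he.measure_preimage ((hf hs).inter (hg hr)).nullMeasurableSet, hfg s r hs hr]

/-- If `f` and `g` are independent functions of a slot, then the past together with `f` is
independent of `g`. -/
lemma indep_past_sup {β γ : Type*} [mβ : MeasurableSpace β] [mγ : MeasurableSpace γ]
    {f : Slot sys.N → β} {g : Slot sys.N → γ} (hfg : IndepFun f g sys.slotLaw) (hf : Measurable f)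
    (hg : Measurable g) (t : ℕ) :
    Indep (sys.past t ⊔ mβ.comap fun ω : sys.Path => f (ω t))
      (mγ.comap fun ω : sys.Path => g (ω t)) sys.P := by
  refine indep_sup_left_of_indep_sup_right (sys.past_le t)
    (hf.comp (measurable_pi_apply t)).comap_le (hg.comp (measurable_pi_apply t)).comap_le
    (indep_of_indep_of_le_right (sys.indep_past_slot t) (sup_le ?_ ?_))
    (indep_comap_comap hfg hf hg t)
  · exact (hf.comp (comap_measurable (fun ω : sys.Path => ω t))).comap_le
  · exact (hg.comp (comap_measurable (fun ω : sys.Path => ω t))).comap_le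

lemma indep_past_comap {γ : Type*} [mγ : MeasurableSpace γ] {g : Slot sys.N → γ}
    (hg : Measurable g) (t : ℕ) :
    Indep (sys.past t) (mγ.comap fun ω : sys.Path => g (ω t)) sys.P :=
  indep_of_indep_of_le_right (sys.indep_past_slot t)
    (hg.comp (comap_measurable (fun ω : sys.Path => ω t))).comap_le

variable (sys)

lemma measure_inter_task1 (t : ℕ) {E : Set sys.Path} (hE : MeasurableSet[sys.info t] E)
    (b : Set (Task sys.N)) :
    sys.P (E ∩ (fun ω => (ω t).task1) ⁻¹' b) = sys.P E * sys.taskLaw b := by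
  have h := indep_past_sup sys.indepFun_seed_task1 Slot.measurable_seed Slot.measurable_task1 t
  rw [Indep_iff] at h
  rw [h E _ hE ⟨b, trivial, rfl⟩, ← slotLaw_task1,
    ← (sys.measurePreserving_eval t).measure_preimage
      (Slot.measurable_task1 trivial).nullMeasurableSet]
  rfl

lemma measure_inter_task2 (t : ℕ) {E : Set sys.Path} (hE : MeasurableSet[sys.info t] E)
    (b : Set (Task sys.N)) :
    sys.P (E ∩ (fun ω => (ω t).task2) ⁻¹' b) = sys.P E * sys.taskLaw b := by
  have h := indep_past_sup sys.indepFun_seed_task2 Slot.measurable_seed Slot.measurable_task2 t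
  rw [Indep_iff] at h
  rw [h E _ hE ⟨b, trivial, rfl⟩, ← slotLaw_task2,
    ← (sys.measurePreserving_eval t).measure_preimage
      (Slot.measurable_task2 trivial).nullMeasurableSet]
  rfl

/-! ### The task selected by a decision -/

/-- The second or the first task of the slot `t`, according to `k = 1` or not. -/
def pick (t : ℕ) (k : sys.Path → ℕ) (ω : sys.Path) : Task sys.N :=
  if k ω = 1 then (ω t).task2 else (ω t).task1

variable {sys} {t : ℕ} {k : sys.Path → ℕ}

lemma measurable_pick (hk : Measurable[sys.info t] k) : Measurable (sys.pick t k) :=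
  Measurable.ite ((hk.mono (sys.info_le t) le_rfl) (measurableSet_singleton 1))
    (Slot.measurable_task2.comp (measurable_pi_apply t))
    (Slot.measurable_task1.comp (measurable_pi_apply t))

/-- The selector `k` is known from `info t`, so `E` splits into two events of `info t` on each of
which the picked task is a fixed one of the two, independent of `info t`. Selecting without looking
at the contents thus does not bias the task. -/
lemma measure_inter_pick (hk : Measurable[sys.info t] k) {E : Set sys.Path}
    (hE : MeasurableSet[sys.info t] E) (b : Set (Task sys.N)) :
    sys.P (E ∩ sys.pick t k ⁻¹' b) = sys.P E * sys.taskLaw b := by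
  have hB : MeasurableSet[sys.info t] (k ⁻¹' {1}) := hk (measurableSet_singleton 1)
  have hB' := sys.info_le t _ hB
  rw [← measure_inter_add_sdiff (E ∩ sys.pick t k ⁻¹' b) hB', ← measure_inter_add_sdiff E hB',
    add_mul, ← measure_inter_task2 sys t (hE.inter hB), ← measure_inter_task1 sys t (hE.diff hB)]
  congr 2
  · ext ω
    simp only [Set.mem_inter_iff, Set.mem_preimage, Set.mem_singleton_iff, pick]
    constructor
    · rintro ⟨⟨h1, h2⟩, h3⟩; rw [if_pos h3] at h2; exact ⟨⟨h1, h3⟩, h2⟩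
    · rintro ⟨⟨h1, h3⟩, h2⟩; rw [if_pos h3]; exact ⟨⟨h1, h2⟩, h3⟩
  · ext ω
    simp only [Set.mem_inter_iff, Set.mem_sdiff, Set.mem_preimage, Set.mem_singleton_iff, pick]
    constructor
    · rintro ⟨⟨h1, h2⟩, h3⟩; rw [if_neg h3] at h2; exact ⟨⟨h1, h3⟩, h2⟩
    · rintro ⟨⟨h1, h3⟩, h2⟩; rw [if_neg h3]; exact ⟨⟨h1, h2⟩, h3⟩

lemma measurePreserving_pick (hk : Measurable[sys.info t] k) :
    MeasurePreserving (sys.pick t k) sys.P sys.taskLaw := by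
  refine ⟨measurable_pick hk, Measure.ext fun b hb => ?_⟩
  rw [Measure.map_apply (measurable_pick hk) hb]
  simpa using measure_inter_pick hk (@MeasurableSet.univ _ (sys.info t)) b

lemma indep_info_pick (hk : Measurable[sys.info t] k) :
    Indep (sys.info t) (MeasurableSpace.comap (sys.pick t k) inferInstance) sys.P := by
  rw [Indep_iff]
  rintro E _ hE ⟨b, hb, rfl⟩
  rw [measure_inter_pick hk hE,
    (measurePreserving_pick hk).measure_preimage hb.nullMeasurableSet]

lemma integrable_pick (hk : Measurable[sys.info t] k) {g : Task sys.N → ℝ}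
    (hg : Integrable g sys.taskLaw) : Integrable (fun ω => g (sys.pick t k ω)) sys.P :=
  (measurePreserving_pick hk).integrable_comp_of_integrable hg

lemma integral_pick (hk : Measurable[sys.info t] k) (g : Task sys.N → ℝ) :
    ∫ ω, g (sys.pick t k ω) ∂sys.P = ∫ h, g h ∂sys.taskLaw := by
  rw [← (measurePreserving_pick hk).map_eq, integral_map (measurable_pick hk).aemeasurable
    (measurable_from_top).aestronglyMeasurable]

end System

namespace System

/-! ### Moments of the data and of the service times -/

section Moments

variable (sys : System)

lemma integrable_length : Integrable (fun h : Task sys.N => (h.length : ℝ)) sys.taskLaw := by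
  refine sys.integrable_sq.mono' measurable_from_top.aestronglyMeasurable (ae_of_all _ fun h => ?_)
  rw [Real.norm_of_nonneg (by positivity)]
  exact_mod_cast Nat.le_self_pow two_ne_zero _

lemma Dlt_nonneg (h : Task sys.N) : 0 ≤ sys.Dlt h :=
  mul_nonneg sys.τ_pos.le (Finset.sum_nonneg fun n _ => by unfold G; split_ifs <;> norm_num)

lemma Dct_nonneg (h : Task sys.N) : 0 ≤ sys.Dct h := mul_nonneg sys.τ_pos.le (Nat.cast_nonneg _)

/-- Local mode counts each requested uncached content once, and a list has no more distinct entries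
than its length. -/
lemma Dlt_le_Dct (h : Task sys.N) : sys.Dlt h ≤ sys.Dct h := by
  refine mul_le_mul_of_nonneg_left ?_ sys.τ_pos.le
  classical
  calc ∑ n, sys.G h n ≤ ∑ n, if n ∈ h.toFinset then (1 : ℝ) else 0 := by
        refine Finset.sum_le_sum fun n _ => ?_
        unfold G
        by_cases hn : n ∈ h <;> simp only [hn, and_true, and_false, List.mem_toFinset] <;>
          split_ifs <;> norm_num
    _ = h.toFinset.card := by
        rw [Finset.sum_ite_mem, Finset.univ_inter, Finset.sum_const, nsmul_one]
    _ ≤ h.length := by exact_mod_cast h.toFinset_card_le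

lemma integrable_Dct : Integrable sys.Dct sys.taskLaw := sys.integrable_length.const_mul sys.τ

lemma integrable_Dlt : Integrable sys.Dlt sys.taskLaw := by
  refine sys.integrable_Dct.mono' measurable_from_top.aestronglyMeasurable (ae_of_all _ fun h => ?_)
  rw [Real.norm_of_nonneg (sys.Dlt_nonneg h)]
  exact sys.Dlt_le_Dct h

lemma meanDlt_nonneg : 0 ≤ sys.meanDlt := integral_nonneg sys.Dlt_nonneg

lemma meanDct_nonneg : 0 ≤ sys.meanDct := integral_nonneg sys.Dct_nonneg

lemma meanDlt_le_meanDct : sys.meanDlt ≤ sys.meanDct :=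
  integral_mono sys.integrable_Dlt sys.integrable_Dct sys.Dlt_le_Dct

lemma integrable_ceil_sq {f : Task sys.N → ℝ} {c : ℝ} (hf : ∀ h, 0 ≤ f h)
    (hfc : ∀ h, f h ≤ c * h.length) :
    Integrable (fun h => ((⌈f h⌉₊ : ℕ) : ℝ) ^ 2) sys.taskLaw := by
  refine ((sys.integrable_sq.const_mul (2 * c ^ 2)).add (integrable_const 2)).mono'
    measurable_from_top.aestronglyMeasurable (ae_of_all _ fun h => ?_)
  rw [Real.norm_of_nonneg (by positivity)]
  have h1 := Nat.ceil_lt_add_one (hf h)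
  have h2 := hfc h
  have h3 : (0 : ℝ) ≤ (⌈f h⌉₊ : ℕ) := by positivity
  simp only [Pi.add_apply]
  have h4 : ((⌈f h⌉₊ : ℕ) : ℝ) ≤ c * h.length + 1 := by linarith
  nlinarith [sq_nonneg (c * h.length - 1)]

lemma service_nonneg {f : ℝ} (hf : 0 < f) {d : ℝ} (hd : 0 ≤ d) (h : Task sys.N) :
    0 ≤ sys.D h * sys.W / (f * sys.Δ) + d / (sys.R * sys.Δ) := by
  have := sys.W_pos
  have := sys.R_pos
  have := sys.Δ_pos
  have : 0 ≤ sys.D h := sys.Dct_nonneg h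
  positivity

lemma service_le {f : ℝ} {h : Task sys.N} {d : ℝ} (hd : d ≤ sys.Dct h) :
    sys.D h * sys.W / (f * sys.Δ) + d / (sys.R * sys.Δ) ≤
      (sys.τ * sys.W / (f * sys.Δ) + sys.τ / (sys.R * sys.Δ)) * h.length := by
  have h1 := sys.R_pos
  have h2 := sys.Δ_pos
  have : d / (sys.R * sys.Δ) ≤ sys.Dct h / (sys.R * sys.Δ) := by gcongr
  have e : sys.D h * sys.W / (f * sys.Δ) + sys.Dct h / (sys.R * sys.Δ) =
      (sys.τ * sys.W / (f * sys.Δ) + sys.τ / (sys.R * sys.Δ)) * h.length := by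
    simp only [Dct, D]; ring
  linarith

lemma one_le_service {f : ℝ} (hf : 0 < f) {d : ℝ} (hd : 0 ≤ d) {h : Task sys.N} (hh : h ≠ []) :
    1 ≤ ⌈sys.D h * sys.W / (f * sys.Δ) + d / (sys.R * sys.Δ)⌉₊ := by
  have := sys.W_pos
  have := sys.R_pos
  have := sys.Δ_pos
  have : 0 < sys.D h :=
    mul_pos sys.τ_pos (by exact_mod_cast List.length_pos_of_ne_nil hh)
  exact Nat.one_le_iff_ne_zero.2 (Nat.ceil_pos.2 (by positivity)).ne'

lemma integrable_Nc_sq : Integrable (fun h => (sys.Nc h : ℝ) ^ 2) sys.taskLaw :=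
  sys.integrable_ceil_sq (fun h => sys.service_nonneg sys.fc_pos (sys.Dct_nonneg h) h)
    (fun _ => sys.service_le le_rfl)

lemma integrable_Nl_sq : Integrable (fun h => (sys.Nl h : ℝ) ^ 2) sys.taskLaw :=
  sys.integrable_ceil_sq (fun h => sys.service_nonneg sys.fl_pos (sys.Dlt_nonneg h) h)
    (fun h => sys.service_le (sys.Dlt_le_Dct h))

lemma ae_one_le_Nc : ∀ᵐ h ∂sys.taskLaw, 1 ≤ sys.Nc h :=
  sys.ae_ne_nil.mono fun h hh => sys.one_le_service sys.fc_pos (sys.Dct_nonneg h) hh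

lemma ae_one_le_Nl : ∀ᵐ h ∂sys.taskLaw, 1 ≤ sys.Nl h :=
  sys.ae_ne_nil.mono fun h hh => sys.one_le_service sys.fl_pos (sys.Dlt_nonneg h) hh

lemma one_le_integral {n : Task sys.N → ℕ} (hn : ∀ᵐ h ∂sys.taskLaw, 1 ≤ n h)
    (hi : Integrable (fun h => (n h : ℝ) ^ 2) sys.taskLaw) : 1 ≤ ∫ h, (n h : ℝ) ∂sys.taskLaw := by
  have hi' : Integrable (fun h => (n h : ℝ)) sys.taskLaw := by
    refine hi.mono' measurable_from_top.aestronglyMeasurable (ae_of_all _ fun h => ?_)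
    rw [Real.norm_of_nonneg (by positivity)]
    exact_mod_cast Nat.le_self_pow two_ne_zero _
  have := integral_mono_ae (integrable_const (1 : ℝ)) hi' (hn.mono fun h hh => by
    simpa using hh)
  simpa using this

lemma one_le_meanNc : 1 ≤ sys.meanNc := sys.one_le_integral sys.ae_one_le_Nc sys.integrable_Nc_sq

lemma one_le_meanNl : 1 ≤ sys.meanNl := sys.one_le_integral sys.ae_one_le_Nl sys.integrable_Nl_sq

end Moments

end System

/-! ### A policy as a pair of servers; expected data -/

namespace Decision

/-- The number of tasks that are started on the mobile device. -/
def ul (u : Decision) : ℕ := u.ul1 + u.ul2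

/-- The number of tasks that are started on the MEC server. -/
def uc (u : Decision) : ℕ := u.uc1 + u.uc2

lemma ul_le_one (u : Decision) : u.ul ≤ 1 := by cases u <;> simp [ul, ul1, ul2]

lemma uc_le_one (u : Decision) : u.uc ≤ 1 := by cases u <;> simp [uc, uc1, uc2]

end Decision

lemma State.le_of_mem_allowed {s : State} {u : Decision} (h : u ∈ s.allowed) :
    u.ul + u.uc ≤ s.Q ∧ (u.ul = 1 → s.Sl = 0) ∧ (u.uc = 1 → s.Sc = 0) := by
  unfold State.allowed at h
  cases u <;> split_ifs at h <;>
    simp_all [Decision.ul, Decision.uc, Decision.ul1, Decision.ul2, Decision.uc1, Decision.uc2] <;>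
    omega

namespace System

/-- At most one of the two local flags is set, so the device sees a single start variable and a
single candidate task. This is the form demanded by `Server`. -/
lemma next_Sl {sys : System} (s : State) (u : Decision) (x : Slot sys.N) : (sys.next s u x).Sl =
    if u.ul = 1 then sys.Nl (if u.ul2 = 1 then x.task2 else x.task1) - 1 else s.Sl - 1 := by
  cases u <;> simp [next, Decision.ul, Decision.ul1, Decision.ul2]

lemma next_Sc {sys : System} (s : State) (u : Decision) (x : Slot sys.N) : (sys.next s u x).Sc =
    if u.uc = 1 then sys.Nc (if u.uc2 = 1 then x.task2 else x.task1) - 1 else s.Sc - 1 := by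
  cases u <;> simp [next, Decision.uc, Decision.uc1, Decision.uc2]

lemma data_eq_of_decision {sys : System} (u : Decision) (x : Slot sys.N) :
    u.ul1 * sys.Dlt x.task1 + u.uc1 * sys.Dct x.task1 +
      (u.ul2 * sys.Dlt x.task2 + u.uc2 * sys.Dct x.task2) =
    u.ul * sys.Dlt (if u.ul2 = 1 then x.task2 else x.task1) +
      u.uc * sys.Dct (if u.uc2 = 1 then x.task2 else x.task1) := by
  cases u <;> simp [Decision.ul, Decision.uc, Decision.ul1, Decision.ul2, Decision.uc1,
    Decision.uc2, add_comm]

namespace Policy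

variable {sys : System} (π : sys.Policy)

/-- The queue length at time `t`. -/
def Q (t : ℕ) (ω : sys.Path) : ℕ := (sys.state π.act ω t).Q

/-- The number of slots during which the mobile device remains busy. -/
def Sl (t : ℕ) (ω : sys.Path) : ℕ := (sys.state π.act ω t).Sl

/-- The number of slots during which the MEC server remains busy. -/
def Sc (t : ℕ) (ω : sys.Path) : ℕ := (sys.state π.act ω t).Sc

/-- The number of tasks that are started on the mobile device in slot `t`. -/
def ul (t : ℕ) (ω : sys.Path) : ℕ := (π.act t ω).ul

/-- The number of tasks that are started on the MEC server in slot `t`. -/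
def uc (t : ℕ) (ω : sys.Path) : ℕ := (π.act t ω).uc

/-- The task of slot `t` that the mobile device may start. -/
def locTask (t : ℕ) : sys.Path → Task sys.N := sys.pick t fun ω => (π.act t ω).ul2

/-- The task of slot `t` that the MEC server may start. -/
def mecTask (t : ℕ) : sys.Path → Task sys.N := sys.pick t fun ω => (π.act t ω).uc2

lemma Q_succ (t : ℕ) (ω : sys.Path) :
    π.Q (t + 1) ω = π.Q t ω - (π.ul t ω + π.uc t ω) + (ω t).A := by
  simp only [Q, state, next, ul, uc, Decision.ul, Decision.uc, add_assoc]

lemma started_le_Q (t : ℕ) (ω : sys.Path) : π.ul t ω + π.uc t ω ≤ π.Q t ω :=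
  (State.le_of_mem_allowed (π.act_mem t ω)).1

lemma Sl_succ (t : ℕ) (ω : sys.Path) : π.Sl (t + 1) ω =
    if π.ul t ω = 1 then sys.Nl (π.locTask t ω) - 1 else π.Sl t ω - 1 :=
  next_Sl _ _ _

lemma Sc_succ (t : ℕ) (ω : sys.Path) : π.Sc (t + 1) ω =
    if π.uc t ω = 1 then sys.Nc (π.mecTask t ω) - 1 else π.Sc t ω - 1 :=
  next_Sc _ _ _

lemma data_eq (t : ℕ) (ω : sys.Path) : π.data t ω =
    π.ul t ω * sys.Dlt (π.locTask t ω) + π.uc t ω * sys.Dct (π.mecTask t ω) :=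
  data_eq_of_decision _ _

lemma measurable_comp_act (f : Decision → ℕ) (t : ℕ) :
    Measurable[sys.info t] fun ω => f (π.act t ω) :=
  measurable_from_top.comp (π.measurable_act t)

lemma measurable_Q (t : ℕ) : Measurable[sys.past t] (π.Q t) := by
  induction t with
  | zero => exact measurable_const
  | succ t ih =>
    have h1 : Measurable[sys.past (t + 1)] (π.Q t) := ih.mono (sys.past_mono t.le_succ) le_rfl
    have h2 : Measurable[sys.past (t + 1)] (π.ul t) :=
      (π.measurable_comp_act _ t).mono (sys.info_le_past t.lt_succ_self) le_rfl
    have h3 : Measurable[sys.past (t + 1)] (π.uc t) :=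
      (π.measurable_comp_act _ t).mono (sys.info_le_past t.lt_succ_self) le_rfl
    have h4 : Measurable[sys.past (t + 1)] (fun ω : sys.Path => (ω t).A) :=
      (Slot.measurable_A.comp (comap_measurable fun ω : sys.Path => ω t)).mono
        (sys.comap_le_past t.lt_succ_self) le_rfl
    have : π.Q (t + 1) = fun ω => π.Q t ω - (π.ul t ω + π.uc t ω) + (ω t).A :=
      funext (π.Q_succ t)
    rw [this]
    exact (h1.sub (h2.add h3)).add h4

lemma measurable_pick_sup_rest (f : Decision → ℕ) (t : ℕ) :
    Measurable[sys.past t ⊔ MeasurableSpace.comap (fun ω : sys.Path => (ω t).rest) inferInstance]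
      (sys.pick t fun ω => f (π.act t ω)) := by
  have hrest : Measurable[sys.past t ⊔
      MeasurableSpace.comap (fun ω : sys.Path => (ω t).rest) inferInstance]
      (fun ω : sys.Path => (ω t).rest) :=
    (comap_measurable fun ω : sys.Path => (ω t).rest).mono le_sup_right le_rfl
  refine Measurable.ite ?_ ?_ ?_
  · exact sys.info_le_past_sup_rest t _ (π.measurable_comp_act f t (measurableSet_singleton 1))
  · exact (measurable_fst.comp measurable_snd).comp hrest
  · exact measurable_fst.comp hrest

lemma measurable_Sl_succ {t : ℕ} (h : Measurable[sys.past t] (π.Sl t)) :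
    Measurable[sys.past t ⊔ MeasurableSpace.comap (fun ω : sys.Path => (ω t).rest) inferInstance]
      (π.Sl (t + 1)) := by
  rw [show π.Sl (t + 1) = _ from funext (π.Sl_succ t)]
  refine Measurable.ite ?_ ?_ ?_
  · exact sys.info_le_past_sup_rest t _
      (π.measurable_comp_act Decision.ul t (measurableSet_singleton 1))
  · exact (measurable_from_top (f := fun h => sys.Nl h - 1)).comp
      (π.measurable_pick_sup_rest _ t)
  · exact (measurable_from_top (f := fun k : ℕ => k - 1)).comp (h.mono le_sup_left le_rfl)

lemma measurable_Sl (t : ℕ) : Measurable[sys.past t] (π.Sl t) := by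
  induction t with
  | zero => exact measurable_const
  | succ t ih => exact (π.measurable_Sl_succ ih).mono (sys.past_sup_rest_le t) le_rfl

lemma measurable_Sc_succ {t : ℕ} (h : Measurable[sys.past t] (π.Sc t)) :
    Measurable[sys.past t ⊔ MeasurableSpace.comap (fun ω : sys.Path => (ω t).rest) inferInstance]
      (π.Sc (t + 1)) := by
  rw [show π.Sc (t + 1) = _ from funext (π.Sc_succ t)]
  refine Measurable.ite ?_ ?_ ?_
  · exact sys.info_le_past_sup_rest t _
      (π.measurable_comp_act Decision.uc t (measurableSet_singleton 1))
  · exact (measurable_from_top (f := fun h => sys.Nc h - 1)).comp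
      (π.measurable_pick_sup_rest _ t)
  · exact (measurable_from_top (f := fun k : ℕ => k - 1)).comp (h.mono le_sup_left le_rfl)

lemma measurable_Sc (t : ℕ) : Measurable[sys.past t] (π.Sc t) := by
  induction t with
  | zero => exact measurable_const
  | succ t ih => exact (π.measurable_Sc_succ ih).mono (sys.past_sup_rest_le t) le_rfl

/-- The mobile device is a server. -/
lemma server_loc : Server sys.P sys.info sys.meanNl (∫ h, (sys.Nl h : ℝ) ^ 2 ∂sys.taskLaw)
    π.ul (fun t ω => sys.Nl (π.locTask t ω)) π.Sl where
  le := sys.info_le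
  u_le_one _ _ := Decision.ul_le_one _
  idle t ω := (State.le_of_mem_allowed (π.act_mem t ω)).2.1
  S_zero _ := rfl
  S_succ := π.Sl_succ
  measurable_u := π.measurable_comp_act Decision.ul
  measurable_S t := (π.measurable_Sl t).mono (sys.past_le_info t) le_rfl
  measurable_n t := (measurable_from_top (f := sys.Nl)).comp
    (measurable_pick (π.measurable_comp_act Decision.ul2 t))
  indep t := indep_of_indep_of_le_right (indep_info_pick (π.measurable_comp_act Decision.ul2 t))
    ((measurable_from_top (f := sys.Nl)).comp (comap_measurable (π.locTask t))).comap_le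
  integrable_sq t := integrable_pick (π.measurable_comp_act Decision.ul2 t) sys.integrable_Nl_sq
  integral_n t := integral_pick (π.measurable_comp_act Decision.ul2 t) fun h => (sys.Nl h : ℝ)
  integral_sq t := integral_pick (π.measurable_comp_act Decision.ul2 t)
    fun h => (sys.Nl h : ℝ) ^ 2

/-- The MEC server is a server. -/
lemma server_mec : Server sys.P sys.info sys.meanNc (∫ h, (sys.Nc h : ℝ) ^ 2 ∂sys.taskLaw)
    π.uc (fun t ω => sys.Nc (π.mecTask t ω)) π.Sc where
  le := sys.info_le
  u_le_one _ _ := Decision.uc_le_one _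
  idle t ω := (State.le_of_mem_allowed (π.act_mem t ω)).2.2
  S_zero _ := rfl
  S_succ := π.Sc_succ
  measurable_u := π.measurable_comp_act Decision.uc
  measurable_S t := (π.measurable_Sc t).mono (sys.past_le_info t) le_rfl
  measurable_n t := (measurable_from_top (f := sys.Nc)).comp
    (measurable_pick (π.measurable_comp_act Decision.uc2 t))
  indep t := indep_of_indep_of_le_right (indep_info_pick (π.measurable_comp_act Decision.uc2 t))
    ((measurable_from_top (f := sys.Nc)).comp (comap_measurable (π.mecTask t))).comap_le
  integrable_sq t := integrable_pick (π.measurable_comp_act Decision.uc2 t) sys.integrable_Nc_sq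
  integral_n t := integral_pick (π.measurable_comp_act Decision.uc2 t) fun h => (sys.Nc h : ℝ)
  integral_sq t := integral_pick (π.measurable_comp_act Decision.uc2 t)
    fun h => (sys.Nc h : ℝ) ^ 2

/-- The expected number of tasks started on the mobile device before `T`. -/
def startsLoc (T : ℕ) : ℝ := ∑ t ∈ Finset.range T, ∫ ω, (π.ul t ω : ℝ) ∂sys.P

/-- The expected number of tasks started on the MEC server before `T`. -/
def startsMec (T : ℕ) : ℝ := ∑ t ∈ Finset.range T, ∫ ω, (π.uc t ω : ℝ) ∂sys.P

lemma startsMec_nonneg (T : ℕ) : 0 ≤ π.startsMec T :=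
  Finset.sum_nonneg fun _ _ => integral_nonneg fun _ => by positivity

lemma data_nonneg (t : ℕ) (ω : sys.Path) : 0 ≤ π.data t ω := by
  rw [data_eq]
  have := sys.Dlt_nonneg (π.locTask t ω)
  have := sys.Dct_nonneg (π.mecTask t ω)
  positivity

lemma integrable_data_loc (t : ℕ) :
    Integrable (fun ω => (π.ul t ω : ℝ) * sys.Dlt (π.locTask t ω)) sys.P :=
  integrable_mul_of_indep (indep_info_pick (π.measurable_comp_act Decision.ul2 t))
    (π.server_loc.measurable_u_real t) measurable_from_top (π.server_loc.integrable_u t)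
    (integrable_pick (π.measurable_comp_act Decision.ul2 t) sys.integrable_Dlt)

lemma integrable_data_mec (t : ℕ) :
    Integrable (fun ω => (π.uc t ω : ℝ) * sys.Dct (π.mecTask t ω)) sys.P :=
  integrable_mul_of_indep (indep_info_pick (π.measurable_comp_act Decision.uc2 t))
    (π.server_mec.measurable_u_real t) measurable_from_top (π.server_mec.integrable_u t)
    (integrable_pick (π.measurable_comp_act Decision.uc2 t) sys.integrable_Dct)

lemma integrable_data (t : ℕ) : Integrable (π.data t) sys.P := by
  rw [show π.data t = _ from funext (π.data_eq t)]
  exact (π.integrable_data_loc t).add (π.integrable_data_mec t)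

/-- The start variables are functions of `info t`, from which the picked task is independent, so
each product of expectations factors. -/
lemma integral_data (t : ℕ) : ∫ ω, π.data t ω ∂sys.P =
    (∫ ω, (π.ul t ω : ℝ) ∂sys.P) * sys.meanDlt + (∫ ω, (π.uc t ω : ℝ) ∂sys.P) * sys.meanDct := by
  simp only [data_eq]
  rw [integral_add (π.integrable_data_loc t) (π.integrable_data_mec t)]
  congr 1
  · rw [meanDlt, ← integral_pick (π.measurable_comp_act Decision.ul2 t) sys.Dlt]
    exact integral_mul_of_indep (indep_info_pick (π.measurable_comp_act Decision.ul2 t))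
      (π.server_loc.measurable_u_real t) measurable_from_top (π.server_loc.integrable_u t)
      (integrable_pick (π.measurable_comp_act Decision.ul2 t) sys.integrable_Dlt)
  · rw [meanDct, ← integral_pick (π.measurable_comp_act Decision.uc2 t) sys.Dct]
    exact integral_mul_of_indep (indep_info_pick (π.measurable_comp_act Decision.uc2 t))
      (π.server_mec.measurable_u_real t) measurable_from_top (π.server_mec.integrable_u t)
      (integrable_pick (π.measurable_comp_act Decision.uc2 t) sys.integrable_Dct)

lemma lintegral_sum_data (T : ℕ) :
    ∫⁻ ω, ENNReal.ofReal (∑ t ∈ Finset.range T, π.data t ω) ∂sys.P =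
      ENNReal.ofReal (π.startsLoc T * sys.meanDlt + π.startsMec T * sys.meanDct) := by
  rw [← ofReal_integral_eq_lintegral_ofReal (integrable_finsetSum _ fun t _ => π.integrable_data t)
    (ae_of_all _ fun ω => Finset.sum_nonneg fun t _ => π.data_nonneg t ω),
    integral_finsetSum _ fun t _ => π.integrable_data t]
  simp only [integral_data, Finset.sum_add_distrib, ← Finset.sum_mul, startsLoc, startsMec]

end Policy

/-! ### Arrivals and conservation of tasks -/

variable (sys : System)

lemma integrable_comp_A {f : ℕ → ℝ} (t : ℕ) :
    Integrable (fun ω : sys.Path => f (ω t).A) sys.P := by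
  have h : Integrable (fun x : Slot sys.N => f x.A) sys.slotLaw := by
    refine (integrable_const (|f 0| + |f 1|)).mono'
      ((measurable_from_nat.comp Slot.measurable_A).aestronglyMeasurable)
      (sys.ae_A_le_one.mono fun x hx => ?_)
    have h0 := abs_nonneg (f 0)
    have h1 := abs_nonneg (f 1)
    rcases Nat.le_one_iff_eq_zero_or_eq_one.1 hx with hx | hx <;> rw [hx, Real.norm_eq_abs] <;>
      linarith
  exact (sys.measurePreserving_eval t).integrable_comp_of_integrable h

lemma integral_comp_eval {f : Slot sys.N → ℝ} (hf : Measurable f) (t : ℕ) :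
    ∫ ω, f (ω t) ∂sys.P = ∫ x, f x ∂sys.slotLaw := by
  have he := sys.measurePreserving_eval t
  rw [← he.map_eq, integral_map he.measurable.aemeasurable hf.aestronglyMeasurable]

lemma integral_arrival (t : ℕ) : ∫ ω, ((ω t).A : ℝ) ∂sys.P = sys.lam := by
  rw [← integral_A]
  exact sys.integral_comp_eval (f := fun x => (x.A : ℝ))
    (measurable_from_nat.comp Slot.measurable_A) t

namespace Policy

variable {sys} (π : sys.Policy)

lemma Q_succ_real (t : ℕ) (ω : sys.Path) :
    (π.Q (t + 1) ω : ℝ) = π.Q t ω - (π.ul t ω + π.uc t ω) + (ω t).A := by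
  rw [Q_succ, Nat.cast_add, Nat.cast_sub (π.started_le_Q t ω), Nat.cast_add]

lemma integrable_Q (t : ℕ) : Integrable (fun ω => (π.Q t ω : ℝ)) sys.P := by
  induction t with
  | zero => simp [Q, state]
  | succ t ih =>
    simp only [Q_succ_real]
    exact (ih.sub ((π.server_loc.integrable_u t).add (π.server_mec.integrable_u t))).add
      (sys.integrable_comp_A (f := fun k => (k : ℝ)) t)

/-- The balance is exact because a decision never starts more than `Q` tasks, so the truncated
subtraction in the dynamics never truncates. -/
lemma integral_Q (T : ℕ) :
    ∫ ω, (π.Q T ω : ℝ) ∂sys.P = sys.lam * T - π.startsLoc T - π.startsMec T := by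
  induction T with
  | zero => simp [Q, state, startsLoc, startsMec]
  | succ T ih =>
    have h1 : Integrable (fun ω => (π.ul T ω : ℝ) + π.uc T ω) sys.P :=
      (π.server_loc.integrable_u T).add (π.server_mec.integrable_u T)
    have h2 : Integrable (fun ω => (π.Q T ω : ℝ) - (π.ul T ω + π.uc T ω)) sys.P :=
      (π.integrable_Q T).sub h1
    simp only [Q_succ_real]
    rw [integral_add h2 (sys.integrable_comp_A (f := fun k => (k : ℝ)) T),
      integral_sub (π.integrable_Q T) h1,
      integral_add (π.server_loc.integrable_u T) (π.server_mec.integrable_u T), ih,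
      integral_arrival]
    simp only [startsLoc, startsMec, Finset.sum_range_succ]
    push_cast
    ring

lemma lintegral_sum_Q (T : ℕ) :
    ∫⁻ ω, ∑ t ∈ Finset.range T, ((sys.state π.act ω t).Q : ℝ≥0∞) ∂sys.P =
      ENNReal.ofReal (∑ t ∈ Finset.range T, ∫ ω, (π.Q t ω : ℝ) ∂sys.P) := by
  rw [← integral_finsetSum _ fun t _ => π.integrable_Q t, ofReal_integral_eq_lintegral_ofReal
    (integrable_finsetSum _ fun t _ => π.integrable_Q t)
    (ae_of_all _ fun ω => Finset.sum_nonneg fun t _ => by positivity)]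
  refine lintegral_congr fun ω => ?_
  rw [ENNReal.ofReal_sum_of_nonneg fun t _ => by positivity]
  simp [Q]

end Policy

end System

/-! ### Rate bounds, lower bounds for the data, and overload -/

namespace System

variable {sys : System}

lemma coe_lam_pos : (0 : ℝ) < sys.lam := sys.lam_pos

lemma exists_mul_le_of_mul_mean_le {m m₂ : ℝ} (hm : 1 ≤ m) {x : ℕ → ℝ}
    (h : ∀ δ : ℝ, 0 < δ → ∀ T : ℕ, x T * m ≤ (1 + δ) * T + m₂ / δ)
    {δ : ℝ} (hδ : 0 < δ) :
    ∃ C : ℝ, ∀ T : ℕ, x T ≤ 1 / m * T + δ * T + C := by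
  refine ⟨m₂ / δ / m, fun T => ?_⟩
  have h1 := h δ hδ T
  have hm0 : 0 < m := by linarith
  rw [← le_div_iff₀ hm0] at h1
  have h2 : δ * T / m ≤ δ * T := div_le_self (by positivity) hm
  have h3 : ((1 + δ) * T + m₂ / δ) / m = 1 / m * T + δ * T / m + m₂ / δ / m := by ring
  linarith

namespace Policy

variable (π : sys.Policy)

lemma exists_startsLoc_le {δ : ℝ} (hδ : 0 < δ) :
    ∃ C : ℝ, ∀ T : ℕ, π.startsLoc T ≤ 1 / sys.meanNl * T + δ * T + C :=
  exists_mul_le_of_mul_mean_le sys.one_le_meanNl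
    (fun _ h T => π.server_loc.sum_integral_u_mul_le_of_pos h T) hδ

lemma exists_startsMec_le {δ : ℝ} (hδ : 0 < δ) :
    ∃ C : ℝ, ∀ T : ℕ, π.startsMec T ≤ 1 / sys.meanNc * T + δ * T + C :=
  exists_mul_le_of_mul_mean_le sys.one_le_meanNc
    (fun _ h T => π.server_mec.sum_integral_u_mul_le_of_pos h T) hδ

lemma integral_Q_nonneg (t : ℕ) : 0 ≤ ∫ ω, (π.Q t ω : ℝ) ∂sys.P :=
  integral_nonneg fun _ => by positivity

variable {π}

lemma exists_eventually_sum_Q_le (hπ : π ∈ sys.feasible) :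
    ∃ C : ℝ, ∀ᶠ T : ℕ in atTop, ∑ t ∈ Finset.range T, ∫ ω, (π.Q t ω : ℝ) ∂sys.P ≤ C * T := by
  obtain ⟨c, hc, hc'⟩ := exists_between (show π.avgQueue < ⊤ from hπ)
  refine ⟨c.toReal, ?_⟩
  filter_upwards [eventually_lt_of_limsup_lt hc, eventually_gt_atTop 0] with T hT hT0
  have hT0' : (0 : ℝ) < T := by exact_mod_cast hT0
  rw [lintegral_sum_Q, ← ENNReal.ofReal_natCast, ← ENNReal.ofReal_div_of_pos hT0',
    ENNReal.ofReal_lt_iff_lt_toReal (div_nonneg (Finset.sum_nonneg fun t _ =>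
      π.integral_Q_nonneg t) hT0'.le) hc'.ne, div_lt_iff₀ hT0'] at hT
  exact hT.le

/-- If `E[Q(T)] > εT` for all large `T`, the block from `n` to `2n` alone contributes at least `εn²`
to the sum, which feasibility bounds by `2Cn`. A bound along infinitely many `T` is enough, since
the objective is a limsup. -/
lemma frequently_integral_Q_le (hπ : π ∈ sys.feasible) {ε : ℝ} (hε : 0 < ε) :
    ∃ᶠ T : ℕ in atTop, ∫ ω, (π.Q T ω : ℝ) ∂sys.P ≤ ε * T := by
  intro hcon
  obtain ⟨C, hC⟩ := exists_eventually_sum_Q_le hπ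
  obtain ⟨T₀, hT₀⟩ := eventually_atTop.1 (hcon.and hC)
  obtain ⟨k, hk⟩ := exists_nat_gt (2 * C / ε)
  set n := max (max T₀ k) 1 with hn
  have hnT : T₀ ≤ n := le_trans (le_max_left _ _) (le_max_left _ _)
  have hnk : k ≤ n := le_trans (le_max_right _ _) (le_max_left _ _)
  have hn1 : 1 ≤ n := le_max_right _ _
  have h1 := (hT₀ (n + n) (by omega)).2
  rw [Finset.sum_range_add] at h1
  have h2 : 0 ≤ ∑ t ∈ Finset.range n, ∫ ω, (π.Q t ω : ℝ) ∂sys.P :=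
    Finset.sum_nonneg fun t _ => π.integral_Q_nonneg t
  have h3 : (n : ℝ) * (ε * n) ≤ ∑ t ∈ Finset.range n, ∫ ω, (π.Q (n + t) ω : ℝ) ∂sys.P := by
    calc (n : ℝ) * (ε * n) = ∑ t ∈ Finset.range n, ε * (n : ℝ) := by simp
      _ ≤ _ := Finset.sum_le_sum fun t _ => by
        have := not_le.1 (hT₀ (n + t) (by omega)).1
        push_cast at this
        nlinarith [(Nat.cast_nonneg t : (0 : ℝ) ≤ t)]
  have h4 : 2 * C < ε * n := by
    rw [div_lt_iff₀ hε] at hk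
    have : (k : ℝ) ≤ n := by exact_mod_cast hnk
    nlinarith
  have h5 : (1 : ℝ) ≤ n := by exact_mod_cast hn1
  push_cast at h1
  nlinarith

/-- A lower bound for the expected data, up to a sublinear error and a multiple of the expected
queue length, is a lower bound for the average data of a feasible policy. -/
lemma le_avgData (hπ : π ∈ sys.feasible) {L K : ℝ} (hK : 0 ≤ K)
    (h : ∀ δ : ℝ, 0 < δ → ∃ C : ℝ, ∀ T : ℕ, sys.lam * L * T ≤
      π.startsLoc T * sys.meanDlt + π.startsMec T * sys.meanDct + δ * T + C +
        K * ∫ ω, (π.Q T ω : ℝ) ∂sys.P) :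
    ENNReal.ofReal L ≤ π.avgData := by
  refine le_of_forall_lt_imp_le_of_dense fun c hc => ?_
  have hctop : c ≠ ⊤ := hc.ne_top
  rw [ENNReal.lt_ofReal_iff_toReal_lt hctop] at hc
  -- The gap is shared by three errors, each at most `dT`: the sublinear term, the constant `C`, and
  -- the multiple of the expected queue length.
  set d := (sys.lam : ℝ) * (L - c.toReal) / 3 with hd
  have hlam := coe_lam_pos (sys := sys)
  have hd0 : 0 < d := by
    have : 0 < L - c.toReal := by linarith
    positivity
  obtain ⟨C, hC⟩ := h d hd0
  obtain ⟨k, hk⟩ := exists_nat_gt (C / d)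
  have hfreq := frequently_integral_Q_le hπ (ε := d / (K + 1)) (by positivity)
  refine le_limsup_of_frequently_le ((hfreq.and_eventually
    (eventually_ge_atTop (max k 1))).mono fun T hT => ?_)
  obtain ⟨hQ, hT⟩ := hT
  have hT1 : 1 ≤ T := le_trans (le_max_right _ _) hT
  have hTk : k ≤ T := le_trans (le_max_left _ _) hT
  have hT0 : (0 : ℝ) < T := by exact_mod_cast hT1
  rw [lintegral_sum_data, ← ENNReal.ofReal_div_of_pos (by positivity),
    ← ENNReal.ofReal_toReal hctop]
  refine ENNReal.ofReal_le_ofReal ?_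
  rw [le_div_iff₀ (by positivity)]
  have h1 := hC T
  have h2 : C ≤ d * T := by
    rw [div_lt_iff₀ hd0] at hk
    have : (k : ℝ) ≤ T := by exact_mod_cast hTk
    nlinarith
  have h3 : K * ∫ ω, (π.Q T ω : ℝ) ∂sys.P ≤ d * T := by
    calc K * ∫ ω, (π.Q T ω : ℝ) ∂sys.P ≤ K * (d / (K + 1) * T) := by gcongr
      _ = K / (K + 1) * (d * T) := by ring
      _ ≤ 1 * (d * T) := by
        gcongr
        rw [div_le_one (by positivity)]
        linarith
      _ = d * T := one_mul _
  have h4 : 3 * d = sys.lam * (L - c.toReal) := by rw [hd]; ring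
  have h5 : 3 * d * T = sys.lam * (L - c.toReal) * T := by rw [h4]
  linarith

lemma avgData_le {L : ℝ} (hL : 0 ≤ L)
    (h : ∀ δ : ℝ, 0 < δ → ∃ C : ℝ, ∀ T : ℕ,
      π.startsLoc T * sys.meanDlt + π.startsMec T * sys.meanDct ≤ sys.lam * L * T + δ * T + C) :
    π.avgData ≤ ENNReal.ofReal L := by
  refine ENNReal.le_of_forall_pos_le_add fun ε hε _ => ?_
  have hlam := coe_lam_pos (sys := sys)
  have hε' : (0 : ℝ) < ε := hε
  set d := (sys.lam : ℝ) * ε / 2 with hd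
  have hd0 : 0 < d := by positivity
  obtain ⟨C, hC⟩ := h d hd0
  obtain ⟨k, hk⟩ := exists_nat_gt (C / d)
  refine limsup_le_of_le (h := ?_)
  filter_upwards [eventually_ge_atTop (max k 1)] with T hT
  have hT1 : 1 ≤ T := le_trans (le_max_right _ _) hT
  have hTk : k ≤ T := le_trans (le_max_left _ _) hT
  have hT0 : (0 : ℝ) < T := by exact_mod_cast hT1
  rw [lintegral_sum_data, ← ENNReal.ofReal_div_of_pos (by positivity),
    ← ENNReal.ofReal_coe_nnreal, ← ENNReal.ofReal_add hL hε'.le]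
  refine ENNReal.ofReal_le_ofReal ?_
  rw [div_le_iff₀ (by positivity)]
  have h1 := hC T
  have h2 : C ≤ d * T := by
    rw [div_lt_iff₀ hd0] at hk
    have : (k : ℝ) ≤ T := by exact_mod_cast hTk
    nlinarith
  have h4 : 2 * d = sys.lam * ε := by rw [hd]; ring
  have h5 : 2 * d * T = sys.lam * ε * T := by rw [h4]
  linarith

/-- Each started task costs at least `meanDlt` on average, and the tasks not yet started are counted
by the queue, whence `K = meanDlt`. -/
lemma meanDlt_le_avgData (hπ : π ∈ sys.feasible) : ENNReal.ofReal sys.meanDlt ≤ π.avgData := by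
  refine le_avgData hπ sys.meanDlt_nonneg fun δ hδ => ⟨0, fun T => ?_⟩
  rw [π.integral_Q]
  have h1 := mul_nonneg (π.startsMec_nonneg T) (sub_nonneg.2 sys.meanDlt_le_meanDct)
  have h2 : 0 ≤ δ * T := by positivity
  nlinarith

/-- Charge `meanDct` to every arrival, the waiting ones through `K = meanDct`. Each local start
refunds `meanDct - meanDlt ≥ 0`, and there are at most `T/meanNl + o(T)` of them. -/
lemma mixed_le_avgData (hπ : π ∈ sys.feasible) : ENNReal.ofReal
    (sys.meanDct - 1 / ((sys.lam : ℝ) * sys.meanNl) * (sys.meanDct - sys.meanDlt)) ≤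
      π.avgData := by
  refine le_avgData hπ sys.meanDct_nonneg fun δ hδ => ?_
  have hlam := coe_lam_pos (sys := sys)
  have hd : 0 ≤ sys.meanDct - sys.meanDlt := sub_nonneg.2 sys.meanDlt_le_meanDct
  set d := sys.meanDct - sys.meanDlt with hdef
  obtain ⟨C, hC⟩ := π.exists_startsLoc_le (δ := δ / (d + 1)) (by positivity)
  refine ⟨d * C, fun T => ?_⟩
  rw [π.integral_Q]
  have h1 := mul_le_mul_of_nonneg_left (hC T) hd
  have h2 : (sys.lam : ℝ) * (sys.meanDct - 1 / ((sys.lam : ℝ) * sys.meanNl) * d) * T =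
      sys.lam * sys.meanDct * T - d * (1 / sys.meanNl * T) := by
    field_simp
  have h3 : d * (δ / (d + 1) * T) ≤ δ * T := by
    calc d * (δ / (d + 1) * T) = d / (d + 1) * (δ * T) := by ring
      _ ≤ 1 * (δ * T) := by
        gcongr
        rw [div_le_one (by positivity)]
        linarith
      _ = δ * T := one_mul _
  rw [h2]
  have h4 : sys.meanDlt = sys.meanDct - d := by rw [hdef]; ring
  rw [h4]
  nlinarith

/-- At the critical arrival rate no policy transmits more data than the formula. -/
lemma avgData_le_of_critical (h : (sys.lam : ℝ) = 1 / sys.meanNl + 1 / sys.meanNc) :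
    π.avgData ≤ ENNReal.ofReal
      (sys.meanDct - 1 / ((sys.lam : ℝ) * sys.meanNl) * (sys.meanDct - sys.meanDlt)) := by
  have hlam := coe_lam_pos (sys := sys)
  have hNl : 0 < sys.meanNl := by linarith [sys.one_le_meanNl]
  have hNc : 0 < sys.meanNc := by linarith [sys.one_le_meanNc]
  -- At the critical rate, `λ` times the formula is the data rate of two devices that never idle,
  -- which the rate bounds make an upper bound for every policy.
  have hL : (sys.lam : ℝ) *
      (sys.meanDct - 1 / ((sys.lam : ℝ) * sys.meanNl) * (sys.meanDct - sys.meanDlt)) =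
      1 / sys.meanNl * sys.meanDlt + 1 / sys.meanNc * sys.meanDct := by
    have : (sys.lam : ℝ) *
      (sys.meanDct - 1 / ((sys.lam : ℝ) * sys.meanNl) * (sys.meanDct - sys.meanDlt)) =
      sys.lam * sys.meanDct - 1 / sys.meanNl * (sys.meanDct - sys.meanDlt) := by field_simp
    rw [this, h]; ring
  have hDl := sys.meanDlt_nonneg
  have hDc := sys.meanDct_nonneg
  refine avgData_le ?_ fun δ hδ => ?_
  · have : 0 ≤ 1 / sys.meanNl * sys.meanDlt + 1 / sys.meanNc * sys.meanDct := by positivity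
    rw [← hL] at this
    exact nonneg_of_mul_nonneg_right this hlam
  · set d := sys.meanDlt + sys.meanDct + 1 with hd
    have hd0 : 0 < d := by positivity
    obtain ⟨C, hC⟩ := π.exists_startsLoc_le (δ := δ / d) (by positivity)
    obtain ⟨C', hC'⟩ := π.exists_startsMec_le (δ := δ / d) (by positivity)
    refine ⟨C * sys.meanDlt + C' * sys.meanDct, fun T => ?_⟩
    rw [hL]
    have h1 := mul_le_mul_of_nonneg_right (hC T) hDl
    have h2 := mul_le_mul_of_nonneg_right (hC' T) hDc
    have h3 : δ / d * T * (sys.meanDlt + sys.meanDct) ≤ δ * T := by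
      calc δ / d * T * (sys.meanDlt + sys.meanDct) ≤ δ / d * T * d := by
            gcongr; linarith
        _ = δ * T := by field_simp
    nlinarith

end Policy

/-- With `g` the excess of `λ` over the total service rate, `E[Q(T)] ≥ gT - o(T)`. The quarters of
`g` pay for the two rate errors, the constants and the assumed bound on `E[Q(T)]`. -/
lemma feasible_eq_empty_of_lt (h : 1 / sys.meanNl + 1 / sys.meanNc < (sys.lam : ℝ)) :
    sys.feasible = ∅ := by
  rw [Set.eq_empty_iff_forall_notMem]
  intro π hπ
  set g := (sys.lam : ℝ) - (1 / sys.meanNl + 1 / sys.meanNc) with hg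
  have hg0 : 0 < g := by linarith
  obtain ⟨C, hC⟩ := π.exists_startsLoc_le (δ := g / 4) (by positivity)
  obtain ⟨C', hC'⟩ := π.exists_startsMec_le (δ := g / 4) (by positivity)
  obtain ⟨k, hk⟩ := exists_nat_gt ((C + C') / (g / 4))
  obtain ⟨T, hT, hkT⟩ := ((Policy.frequently_integral_Q_le hπ (ε := g / 4)
    (by positivity)).and_eventually (eventually_ge_atTop k)).exists
  rw [π.integral_Q] at hT
  rw [div_lt_iff₀ (by positivity)] at hk
  have h1 : (k : ℝ) ≤ T := by exact_mod_cast hkT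
  have h2 := hC T
  have h3 := hC' T
  have h4 : (sys.lam : ℝ) = g + 1 / sys.meanNl + 1 / sys.meanNc := by rw [hg]; ring
  have h5 : (sys.lam : ℝ) * T = g * T + 1 / sys.meanNl * T + 1 / sys.meanNc * T := by
    rw [h4]; ring
  nlinarith

end System

/-! ### Infeasibility at the critical rate by martingale convergence -/

/-- A nondecreasing sequence whose averages are eventually bounded is bounded. -/
lemma exists_le_of_monotone_of_sum_le {x : ℕ → ℝ} (hx : Monotone x) (hx0 : ∀ n, 0 ≤ x n) {C : ℝ}
    (hC : ∀ᶠ T : ℕ in atTop, ∑ t ∈ Finset.range T, x t ≤ C * T) : ∃ R : ℝ, ∀ n, x n ≤ R := by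
  obtain ⟨T₀, hT₀⟩ := eventually_atTop.1 hC
  refine ⟨2 * C, fun k => ?_⟩
  set n := max (max T₀ k) 1 with hn
  have hnT : T₀ ≤ n := le_trans (le_max_left _ _) (le_max_left _ _)
  have hnk : k ≤ n := le_trans (le_max_right _ _) (le_max_left _ _)
  have hn1 : (1 : ℝ) ≤ n := by exact_mod_cast (le_max_right _ _ : 1 ≤ n)
  have h1 := hT₀ (n + n) (by omega)
  rw [Finset.sum_range_add] at h1
  have h2 : 0 ≤ ∑ t ∈ Finset.range n, x t := Finset.sum_nonneg fun t _ => hx0 t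
  have h3 : (n : ℝ) * x n ≤ ∑ t ∈ Finset.range n, x (n + t) := by
    calc (n : ℝ) * x n = ∑ t ∈ Finset.range n, x n := by simp
      _ ≤ _ := Finset.sum_le_sum fun t _ => hx (Nat.le_add_right _ _)
  have h4 := hx hnk
  push_cast at h1
  have h5 : (n : ℝ) * x n ≤ n * (2 * C) := by linarith
  exact h4.trans (le_of_mul_le_mul_left h5 (by linarith))

namespace System

variable {sys : System}

variable (sys) in
/-- The filtration of the slots before `t`. -/
def pastFiltration : Filtration ℕ (MeasurableSpace.pi : MeasurableSpace sys.Path) where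
  seq := sys.past
  mono' _ _ h := sys.past_mono h
  le' := sys.past_le

/-- A variable that is independent of the arrival does not cancel it. -/
lemma min_le_measureReal_abs_arrival_add {t : ℕ} {g : sys.Path → ℝ}
    (hg : Measurable[sys.past t ⊔
      MeasurableSpace.comap (fun ω : sys.Path => (ω t).rest) inferInstance] g) :
    min (sys.lam : ℝ) (1 - sys.lam) ≤ sys.P.real {ω | 1 / 2 ≤ |((ω t).A : ℝ) + g ω|} := by
  have hind := indep_past_sup sys.indepFun_A_rest.symm Slot.measurable_rest Slot.measurable_A t
  rw [Indep_iff] at hind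
  have hle : sys.past t ⊔ MeasurableSpace.comap (fun ω : sys.Path => (ω t).rest) inferInstance ≤
      MeasurableSpace.pi := (sys.past_sup_rest_le t).trans (sys.past_le (t + 1))
  have hH : ∀ k : ℝ, MeasurableSet[sys.past t ⊔
      MeasurableSpace.comap (fun ω : sys.Path => (ω t).rest) inferInstance]
      {ω | 1 / 2 ≤ |k + g ω|} := fun k =>
    (continuous_const.add continuous_id).abs.measurable.comp hg (measurableSet_Ici (a := (1 / 2 : ℝ)))
  have hA : ∀ k : ℕ, MeasurableSet ((fun ω : sys.Path => (ω t).A) ⁻¹' {k}) := fun k =>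
    (Slot.measurable_A.comp (measurable_pi_apply t) :
      Measurable fun ω : sys.Path => (ω t).A) (measurableSet_singleton k)
  have hPA : ∀ k : ℕ, sys.P ((fun ω : sys.Path => (ω t).A) ⁻¹' {k}) =
      bernoulliMeasure (1 : ℕ) 0 sys.lam {k} := fun k => by
    rw [← slotLaw_A, ← (sys.measurePreserving_eval t).measure_preimage
      (Slot.measurable_A (measurableSet_singleton k)).nullMeasurableSet]
    rfl
  have hprod : ∀ k : ℕ, sys.P.real ({ω | 1 / 2 ≤ |(k : ℝ) + g ω|} ∩ (fun ω => (ω t).A) ⁻¹' {k}) =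
      sys.P.real {ω | 1 / 2 ≤ |(k : ℝ) + g ω|} *
        (bernoulliMeasure (1 : ℕ) 0 sys.lam).real {k} := fun k => by
    simp only [measureReal_def]
    rw [← ENNReal.toReal_mul, ← hPA, hind _ _ (hH k) ⟨{k}, measurableSet_singleton k, rfl⟩]
  have h0 := hprod 0
  have h1 := hprod 1
  rw [bernoulliMeasure_real_apply_of_notMem_of_mem _ (measurableSet_singleton 0) (by simp)
    (by simp)] at h0
  rw [bernoulliMeasure_real_apply_of_mem_of_notMem _ (measurableSet_singleton 1) (by simp)
    (by simp)] at h1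
  -- The numbers `g` and `1 + g` cannot both have absolute value below `1/2`, so one of the two
  -- events always occurs.
  have hcover : 1 ≤ sys.P.real {ω | 1 / 2 ≤ |((0 : ℕ) : ℝ) + g ω|} +
      sys.P.real {ω | 1 / 2 ≤ |((1 : ℕ) : ℝ) + g ω|} := by
    refine le_trans (le_of_eq (probReal_univ.symm.trans (congrArg sys.P.real
      (Set.eq_univ_iff_forall.2 fun ω => ?_).symm))) (measureReal_union_le _ _)
    by_contra hω
    simp only [Set.mem_union, Set.mem_ofPred_eq, not_or, not_le, Nat.cast_zero, Nat.cast_one,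
      abs_lt] at hω
    linarith [hω.1.1, hω.1.2, hω.2.1, hω.2.2]
  have hsum : sys.P.real ({ω | 1 / 2 ≤ |((0 : ℕ) : ℝ) + g ω|} ∩ (fun ω => (ω t).A) ⁻¹' {0}) +
      sys.P.real ({ω | 1 / 2 ≤ |((1 : ℕ) : ℝ) + g ω|} ∩ (fun ω => (ω t).A) ⁻¹' {1}) ≤
      sys.P.real {ω | 1 / 2 ≤ |((ω t).A : ℝ) + g ω|} := by
    rw [← measureReal_union]
    · refine measureReal_mono ?_
      rintro ω (⟨h, h'⟩ | ⟨h, h'⟩)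
      · simp only [Set.mem_ofPred_eq, Set.mem_preimage, Set.mem_singleton_iff] at h h' ⊢; rwa [h']
      · simp only [Set.mem_ofPred_eq, Set.mem_preimage, Set.mem_singleton_iff] at h h' ⊢; rwa [h']
    · rw [Set.disjoint_left]
      rintro ω ⟨-, h⟩ ⟨-, h'⟩
      simp only [Set.mem_preimage, Set.mem_singleton_iff] at h h'
      omega
    · exact (hle _ (hH _)).inter (hA 1)
  rw [h0, h1] at hsum
  have hl : (0 : ℝ) ≤ sys.lam := sys.lam.2.1
  have hl' : (sys.lam : ℝ) ≤ 1 := sys.lam.2.2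
  have p0 := measureReal_nonneg (μ := sys.P) (s := {ω | 1 / 2 ≤ |((0 : ℕ) : ℝ) + g ω|})
  have p1 := measureReal_nonneg (μ := sys.P) (s := {ω | 1 / 2 ≤ |((1 : ℕ) : ℝ) + g ω|})
  have m0 := min_le_left (sys.lam : ℝ) (1 - sys.lam)
  have m1 := min_le_right (sys.lam : ℝ) (1 - sys.lam)
  have m2 : 0 ≤ min (sys.lam : ℝ) (1 - sys.lam) := le_min hl (by linarith)
  nlinarith

namespace Policy

variable (π : sys.Policy)

/-- The normalized expected workload. -/
def load (t : ℕ) (ω : sys.Path) : ℝ :=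
  π.Q t ω + π.Sl t ω / sys.meanNl + π.Sc t ω / sys.meanNc

lemma load_nonneg (t : ℕ) (ω : sys.Path) : 0 ≤ π.load t ω := by
  have := sys.one_le_meanNl
  have := sys.one_le_meanNc
  unfold load
  positivity

lemma measurable_load (t : ℕ) : Measurable[sys.past t] (π.load t) := by
  have h1 : Measurable[sys.past t] fun ω => (π.Q t ω : ℝ) :=
    measurable_from_nat.comp (π.measurable_Q t)
  have h2 : Measurable[sys.past t] fun ω => (π.Sl t ω : ℝ) :=
    measurable_from_nat.comp (π.measurable_Sl t)
  have h3 : Measurable[sys.past t] fun ω => (π.Sc t ω : ℝ) :=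
    measurable_from_nat.comp (π.measurable_Sc t)
  exact (h1.add (h2.div_const _)).add (h3.div_const _)

lemma integrable_load (t : ℕ) : Integrable (π.load t) sys.P :=
  ((π.integrable_Q t).add ((π.server_loc.integrable_S t).div_const _)).add
    ((π.server_mec.integrable_S t).div_const _)

/-- The increment of the load, without the arrival, depends on the past, the seed and the tasks. -/
lemma measurable_load_succ_sub (t : ℕ) : Measurable[sys.past t ⊔
    MeasurableSpace.comap (fun ω : sys.Path => (ω t).rest) inferInstance]
    fun ω => π.load (t + 1) ω - π.load t ω - (ω t).A := by
  set m := sys.past t ⊔ MeasurableSpace.comap (fun ω : sys.Path => (ω t).rest) inferInstance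
  have hle : sys.past t ≤ m := le_sup_left
  have h1 : Measurable[m] fun ω => (π.ul t ω : ℝ) :=
    (π.server_loc.measurable_u_real t).mono (sys.info_le_past_sup_rest t) le_rfl
  have h2 : Measurable[m] fun ω => (π.uc t ω : ℝ) :=
    (π.server_mec.measurable_u_real t).mono (sys.info_le_past_sup_rest t) le_rfl
  have h3 : Measurable[m] fun ω => (π.Sl (t + 1) ω : ℝ) :=
    measurable_from_nat.comp (π.measurable_Sl_succ (π.measurable_Sl t))
  have h4 : Measurable[m] fun ω => (π.Sc (t + 1) ω : ℝ) :=
    measurable_from_nat.comp (π.measurable_Sc_succ (π.measurable_Sc t))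
  have h5 : Measurable[m] fun ω => (π.Q t ω : ℝ) :=
    measurable_from_nat.comp ((π.measurable_Q t).mono hle le_rfl)
  have h6 : Measurable[m] (π.load t) := (π.measurable_load t).mono hle le_rfl
  have heq : (fun ω => π.load (t + 1) ω - π.load t ω - (ω t).A) = fun ω =>
      (π.Q t ω : ℝ) - (π.ul t ω + π.uc t ω) + π.Sl (t + 1) ω / sys.meanNl +
        π.Sc (t + 1) ω / sys.meanNc - π.load t ω := by
    funext ω
    rw [load, π.Q_succ_real]
    ring
  rw [heq]
  exact (((h5.sub (h1.add h2)).add (h3.div_const _)).add (h4.div_const _)).sub h6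

/-- Given the past, an arrival adds `λ` in expectation; a start removes one task from the queue and
adds normalized work of mean one; one slot of service removes at most `1/meanNl + 1/meanNc`, which
is `λ`. Idleness can only make the load larger. -/
lemma setIntegral_load_le (h : (sys.lam : ℝ) = 1 / sys.meanNl + 1 / sys.meanNc) (t : ℕ)
    {s : Set sys.Path} (hs : MeasurableSet[sys.past t] s) :
    ∫ ω in s, π.load t ω ∂sys.P ≤ ∫ ω in s, π.load (t + 1) ω ∂sys.P := by
  have hNl : 0 < sys.meanNl := by linarith [sys.one_le_meanNl]
  have hNc : 0 < sys.meanNc := by linarith [sys.one_le_meanNc]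
  have hs' := sys.past_le t _ hs
  have hsi := sys.past_le_info t _ hs
  have iA : Integrable (fun ω : sys.Path => ((ω t).A : ℝ)) sys.P :=
    sys.integrable_comp_A (f := fun k => (k : ℝ)) t
  have il := π.server_loc.integrable_u t
  have ic := π.server_mec.integrable_u t
  have iln := π.server_loc.integrable_mul_n (π.server_loc.measurable_u_real t) il
  have icn := π.server_mec.integrable_mul_n (π.server_mec.measurable_u_real t) ic
  have eA : ∫ ω in s, ((ω t).A : ℝ) ∂sys.P = sys.P.real s * sys.lam := by
    rw [← integral_indicator hs', ← sys.integral_arrival t, ← integral_indicator_one hs']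
    have := integral_mul_of_indep (g := fun k : ℕ => (k : ℝ)) (X := s.indicator 1)
      (indep_past_comap (sys := sys) Slot.measurable_A t)
      (Measurable.indicator (m := sys.past t) measurable_const hs) measurable_from_nat
      ((integrable_const 1).indicator hs') iA
    rw [← this]
    refine integral_congr_ae (ae_of_all _ fun ω => ?_)
    by_cases hω : ω ∈ s <;> simp [hω]
  have el : ∫ ω in s, (π.ul t ω : ℝ) * sys.Nl (π.locTask t ω) ∂sys.P =
      (∫ ω in s, (π.ul t ω : ℝ) ∂sys.P) * sys.meanNl := by
    rw [← integral_indicator hs', ← integral_indicator hs', ← π.server_loc.integral_mul_n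
      ((π.server_loc.measurable_u_real t).indicator hsi) (il.indicator hs')]
    refine integral_congr_ae (ae_of_all _ fun ω => ?_)
    by_cases hω : ω ∈ s <;> simp [hω]
  have ec : ∫ ω in s, (π.uc t ω : ℝ) * sys.Nc (π.mecTask t ω) ∂sys.P =
      (∫ ω in s, (π.uc t ω : ℝ) ∂sys.P) * sys.meanNc := by
    rw [← integral_indicator hs', ← integral_indicator hs', ← π.server_mec.integral_mul_n
      ((π.server_mec.measurable_u_real t).indicator hsi) (ic.indicator hs')]
    refine integral_congr_ae (ae_of_all _ fun ω => ?_)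
    by_cases hω : ω ∈ s <;> simp [hω]
  have i1 : Integrable (fun ω => π.load t ω + (ω t).A) sys.P := (π.integrable_load t).add iA
  have i2 : Integrable (fun ω => π.load t ω + (ω t).A - π.ul t ω) sys.P := i1.sub il
  have i3 : Integrable (fun ω => π.load t ω + (ω t).A - π.ul t ω - π.uc t ω) sys.P := i2.sub ic
  have i4 : Integrable (fun ω => π.load t ω + (ω t).A - π.ul t ω - π.uc t ω +
      π.ul t ω * sys.Nl (π.locTask t ω) / sys.meanNl) sys.P := i3.add (iln.div_const _)
  have i5 : Integrable (fun ω => π.load t ω + (ω t).A - π.ul t ω - π.uc t ω +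
      π.ul t ω * sys.Nl (π.locTask t ω) / sys.meanNl +
      π.uc t ω * sys.Nc (π.mecTask t ω) / sys.meanNc) sys.P := i4.add (icn.div_const _)
  have hpt : ∀ ω, π.load t ω + (ω t).A - π.ul t ω - π.uc t ω +
      π.ul t ω * sys.Nl (π.locTask t ω) / sys.meanNl +
      π.uc t ω * sys.Nc (π.mecTask t ω) / sys.meanNc - sys.lam ≤ π.load (t + 1) ω := fun ω => by
    have h1 := div_le_div_of_nonneg_right (π.server_loc.add_mul_le_succ t ω) hNl.le
    have h2 := div_le_div_of_nonneg_right (π.server_mec.add_mul_le_succ t ω) hNc.le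
    rw [sub_div, add_div] at h1 h2
    rw [load, load, π.Q_succ_real, h]
    linarith
  have key := integral_mono (μ := sys.P.restrict s)
    ((i5.sub (integrable_const (sys.lam : ℝ))).integrableOn)
    (π.integrable_load (t + 1)).integrableOn hpt
  refine le_trans (le_of_eq ?_) key
  simp only [Pi.sub_apply]
  rw [integral_sub i5.integrableOn (integrable_const _),
    integral_add i4.integrableOn (icn.div_const _).integrableOn,
    integral_add i3.integrableOn (iln.div_const _).integrableOn,
    integral_sub i2.integrableOn ic.integrableOn, integral_sub i1.integrableOn il.integrableOn,
    integral_add (π.integrable_load t).integrableOn iA.integrableOn,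
    integral_div, integral_div, el, ec, eA, mul_div_cancel_right₀ _ hNl.ne',
    mul_div_cancel_right₀ _ hNc.ne']
  simp
  ring

lemma submartingale_load (h : (sys.lam : ℝ) = 1 / sys.meanNl + 1 / sys.meanNc) :
    Submartingale π.load sys.pastFiltration sys.P :=
  submartingale_of_setIntegral_le_succ (fun t => (π.measurable_load t).stronglyMeasurable)
    π.integrable_load fun t _ hs => π.setIntegral_load_le h t hs

variable {π}

/-- Feasibility controls only time averages, of `Q` by definition and of the residual times by
`sum_integral_S_le`. Expected loads are nondecreasing, so bounded averages force a uniform bound. -/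
lemma exists_integral_load_le (hπ : π ∈ sys.feasible)
    (h : (sys.lam : ℝ) = 1 / sys.meanNl + 1 / sys.meanNc) :
    ∃ R : ℝ, ∀ t, ∫ ω, π.load t ω ∂sys.P ≤ R := by
  obtain ⟨C, hC⟩ := exists_eventually_sum_Q_le hπ
  refine exists_le_of_monotone_of_sum_le (C := C + (∫ h, (sys.Nl h : ℝ) ^ 2 ∂sys.taskLaw) +
    ∫ h, (sys.Nc h : ℝ) ^ 2 ∂sys.taskLaw) (monotone_nat_of_le_succ fun t => ?_)
    (fun t => integral_nonneg (π.load_nonneg t)) ?_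
  · simpa using π.setIntegral_load_le h t (@MeasurableSet.univ _ (sys.past t))
  · filter_upwards [hC] with T hT
    have hl := π.server_loc.sum_integral_S_le T
    have hc := π.server_mec.sum_integral_S_le T
    have hle : ∀ t, ∫ ω, π.load t ω ∂sys.P ≤ ∫ ω, (π.Q t ω : ℝ) ∂sys.P +
        ∫ ω, (π.Sl t ω : ℝ) ∂sys.P + ∫ ω, (π.Sc t ω : ℝ) ∂sys.P := fun t => by
      have j1 : Integrable (fun ω => (π.Q t ω : ℝ) + π.Sl t ω) sys.P :=
        (π.integrable_Q t).add (π.server_loc.integrable_S t)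
      rw [← integral_add (π.integrable_Q t) (π.server_loc.integrable_S t),
        ← integral_add j1 (π.server_mec.integrable_S t)]
      refine integral_mono (π.integrable_load t) (j1.add (π.server_mec.integrable_S t)) fun ω => ?_
      exact add_le_add (add_le_add le_rfl (div_le_self (by positivity) sys.one_le_meanNl))
        (div_le_self (by positivity) sys.one_le_meanNc)
    have := Finset.sum_le_sum fun t (_ : t ∈ Finset.range T) => hle t
    rw [Finset.sum_add_distrib, Finset.sum_add_distrib] at this
    linarith

end Policy

/-- The load would converge almost surely, so its increments would vanish in probability; but an
increment is the arrival plus an independent variable, and has absolute value at least `1/2` with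
probability at least `min λ (1 - λ) > 0`. -/
lemma feasible_eq_empty_of_critical (h : (sys.lam : ℝ) = 1 / sys.meanNl + 1 / sys.meanNc)
    (hlam : (sys.lam : ℝ) < 1) : sys.feasible = ∅ := by
  rw [Set.eq_empty_iff_forall_notMem]
  intro π hπ
  obtain ⟨R, hR⟩ := Policy.exists_integral_load_le hπ h
  have hconv := (π.submartingale_load h).exists_ae_tendsto_of_bdd (R := R.toNNReal) fun t => by
    rw [eLpNorm_one_eq_lintegral_enorm, ← ofReal_integral_norm_eq_lintegral_enorm
      (π.integrable_load t)]
    refine ENNReal.ofReal_le_ofReal ?_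
    simp only [Real.norm_of_nonneg (π.load_nonneg t _)]
    exact hR t
  have hincr : ∀ᵐ ω ∂sys.P, Tendsto (fun t => π.load (t + 1) ω - π.load t ω) atTop
      (nhds ((fun _ => (0 : ℝ)) ω)) := by
    filter_upwards [hconv] with ω ⟨c, hc⟩
    simpa using ((tendsto_add_atTop_iff_nat 1).2 hc).sub hc
  have hmeas := tendstoInMeasure_of_tendsto_ae (fun t =>
    ((π.integrable_load (t + 1)).sub (π.integrable_load t)).1) hincr
  rw [tendstoInMeasure_iff_measureReal_norm] at hmeas
  have hlim := hmeas (1 / 2) (by norm_num)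
  have hbound := ge_of_tendsto' hlim fun t => by
    have := min_le_measureReal_abs_arrival_add (π.measurable_load_succ_sub t)
    simpa only [add_sub_cancel, sub_zero, Real.norm_eq_abs, Pi.sub_apply] using this
  have : 0 < min (sys.lam : ℝ) (1 - sys.lam) := lt_min coe_lam_pos (by linarith)
  linarith

end System

/-! ### The random splitting policy -/

section Splitting

variable {N : ℕ}

/-- An arrival that is assigned to the mobile device, which happens with probability `p`. -/
def Slot.arrLoc (p : I) (x : Slot N) : ℕ := if x.seed ≤ p then x.A else 0

/-- An arrival that is assigned to the MEC server, which happens with probability `1 - p`. -/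
def Slot.arrMec (p : I) (x : Slot N) : ℕ := if x.seed ≤ p then 0 else x.A

lemma Slot.measurable_arrLoc (p : I) : Measurable (Slot.arrLoc (N := N) p) :=
  Measurable.ite (Slot.measurable_seed measurableSet_Iic) Slot.measurable_A measurable_const

lemma Slot.measurable_arrMec (p : I) : Measurable (Slot.arrMec (N := N) p) :=
  Measurable.ite (Slot.measurable_seed measurableSet_Iic) measurable_const Slot.measurable_A

lemma Slot.arrLoc_add_arrMec (p : I) (x : Slot N) : x.arrLoc p + x.arrMec p = x.A := by
  unfold arrLoc arrMec
  split_ifs <;> simp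

/-- The state `(Q_l, Q_c, S_l, S_c)` of a system with a separate queue for each device. -/
abbrev SplitState : Type := ℕ × ℕ × ℕ × ℕ

/-- The state with both queues merged. -/
def SplitState.merge (s : SplitState) : State := ⟨s.1 + s.2.1, s.2.2.1, s.2.2.2⟩

/-- Each device starts a task of its own queue whenever possible. -/
def SplitState.decision (s : SplitState) : Decision :=
  if s.2.2.1 = 0 ∧ 0 < s.1 then
    -- The decision `.mecLoc` is not needed: the two queues only count tasks, and the two tasks of a
    -- slot have the same law.
    if s.2.2.2 = 0 ∧ 0 < s.2.1 then .locMec else .loc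
  else if s.2.2.2 = 0 ∧ 0 < s.2.1 then .mec else .none

lemma SplitState.ul_decision (s : SplitState) :
    s.decision.ul = if s.2.2.1 = 0 ∧ 0 < s.1 then 1 else 0 := by
  unfold decision
  split_ifs <;> rfl

lemma SplitState.uc_decision (s : SplitState) :
    s.decision.uc = if s.2.2.2 = 0 ∧ 0 < s.2.1 then 1 else 0 := by
  unfold decision
  split_ifs <;> rfl

lemma State.mem_allowed {s : State} {u : Decision} (hQ : u.ul + u.uc ≤ s.Q)
    (hl : u.ul = 1 → s.Sl = 0) (hc : u.uc = 1 → s.Sc = 0) : u ∈ s.allowed := by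
  unfold State.allowed
  cases u <;>
    simp only [Decision.ul, Decision.uc, Decision.ul1, Decision.ul2, Decision.uc1,
      Decision.uc2, forall_const] at hQ hl hc <;>
    split_ifs <;> first | (exfalso; omega) | simp

lemma SplitState.ul_decision_le (s : SplitState) : s.decision.ul ≤ s.1 := by
  rw [s.ul_decision]
  split_ifs <;> omega

lemma SplitState.uc_decision_le (s : SplitState) : s.decision.uc ≤ s.2.1 := by
  rw [s.uc_decision]
  split_ifs <;> omega

lemma SplitState.decision_mem_allowed (s : SplitState) : s.decision ∈ s.merge.allowed := by
  refine State.mem_allowed (add_le_add s.ul_decision_le s.uc_decision_le) ?_ ?_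
  · rw [s.ul_decision]
    exact fun h => (by_contra fun h' => by rw [if_neg fun h'' => h' h''.1] at h; omega)
  · rw [s.uc_decision]
    exact fun h => (by_contra fun h' => by rw [if_neg fun h'' => h' h''.1] at h; omega)

end Splitting

namespace System

variable {sys : System}

variable (sys) in
/-- One step of the system with two queues. -/
def splitNext (p : I) (s : SplitState) (x : Slot sys.N) : SplitState :=
  (s.1 - s.decision.ul + x.arrLoc p, s.2.1 - s.decision.uc + x.arrMec p,
    (sys.next s.merge s.decision x).Sl, (sys.next s.merge s.decision x).Sc)

/-- Each device takes at most what its own queue holds, so the two truncated subtractions add up to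
the one in the merged queue. -/
lemma merge_splitNext (p : I) (s : SplitState) (x : Slot sys.N) :
    (sys.splitNext p s x).merge = sys.next s.merge s.decision x := by
  have h1 := s.ul_decision_le
  have h2 := s.uc_decision_le
  have h3 := x.arrLoc_add_arrMec p
  have h4 : (sys.splitNext p s x).merge.Q = (sys.next s.merge s.decision x).Q := by
    simp only [splitNext, SplitState.merge, next, ← h3]
    simp only [Decision.ul, Decision.uc] at h1 h2 ⊢
    omega
  calc (sys.splitNext p s x).merge = ⟨(sys.splitNext p s x).merge.Q,
        (sys.next s.merge s.decision x).Sl, (sys.next s.merge s.decision x).Sc⟩ := rfl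
    _ = _ := by rw [h4]

lemma measurable_splitNext (p : I) :
    Measurable fun z : SplitState × Slot sys.N => sys.splitNext p z.1 z.2 := by
  refine measurable_from_prod_countable_right fun s => ?_
  simp only [splitNext]
  refine ((Slot.measurable_arrLoc p).const_add _).prodMk
    (((Slot.measurable_arrMec p).const_add _).prodMk (Measurable.prodMk ?_ ?_))
  · simp only [next]
    split_ifs
    · exact (measurable_from_top (f := fun h => sys.Nl h - 1)).comp Slot.measurable_task1
    · exact (measurable_from_top (f := fun h => sys.Nl h - 1)).comp Slot.measurable_task2
    · exact measurable_const
  · simp only [next]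
    split_ifs
    · exact (measurable_from_top (f := fun h => sys.Nc h - 1)).comp Slot.measurable_task1
    · exact (measurable_from_top (f := fun h => sys.Nc h - 1)).comp Slot.measurable_task2
    · exact measurable_const

variable (sys) in
/-- The evolution of the system with two queues. -/
def splitPath (p : I) (ω : sys.Path) : ℕ → SplitState
  | 0 => (0, 0, 0, 0)
  | t + 1 => sys.splitNext p (splitPath p ω t) (ω t)

/-- The seed of a slot labels the arrival of that same slot, which joins a queue only in the next
one. The policy therefore uses past seeds only, and never the current one. -/
lemma measurable_splitPath (p : I) (t : ℕ) :
    Measurable[sys.past t] fun ω => sys.splitPath p ω t := by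
  induction t with
  | zero => exact measurable_const
  | succ t ih =>
    have h1 : Measurable[sys.past (t + 1)] fun ω => sys.splitPath p ω t :=
      ih.mono (sys.past_mono t.le_succ) le_rfl
    have h2 : Measurable[sys.past (t + 1)] fun ω : sys.Path => ω t :=
      (comap_measurable fun ω : sys.Path => ω t).mono (sys.comap_le_past t.lt_succ_self) le_rfl
    exact (measurable_splitNext p).comp (h1.prodMk h2)

lemma state_eq_merge_splitPath (p : I) (ω : sys.Path) (t : ℕ) :
    sys.state (fun t ω => (sys.splitPath p ω t).decision) ω t = (sys.splitPath p ω t).merge := by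
  induction t with
  | zero => rfl
  | succ t ih => rw [state, ih, splitPath, merge_splitNext]

variable (sys) in
/-- The policy that assigns each arrival at random to one of the devices. -/
def splitPolicy (p : I) : sys.Policy where
  act t ω := (sys.splitPath p ω t).decision
  measurable_act t := (Measurable.of_discrete (f := SplitState.decision)).comp
    ((measurable_splitPath p t).mono (sys.past_le_info t) le_rfl)
  act_mem t ω := by
    rw [state_eq_merge_splitPath]
    exact SplitState.decision_mem_allowed _

lemma splitPolicy_Q (p : I) (t : ℕ) (ω : sys.Path) :
    (sys.splitPolicy p).Q t ω = (sys.splitPath p ω t).1 + (sys.splitPath p ω t).2.1 :=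
  congrArg State.Q (state_eq_merge_splitPath p ω t)

lemma splitPolicy_Sl (p : I) (t : ℕ) (ω : sys.Path) :
    (sys.splitPolicy p).Sl t ω = (sys.splitPath p ω t).2.2.1 :=
  congrArg State.Sl (state_eq_merge_splitPath p ω t)

lemma splitPolicy_Sc (p : I) (t : ℕ) (ω : sys.Path) :
    (sys.splitPolicy p).Sc t ω = (sys.splitPath p ω t).2.2.2 :=
  congrArg State.Sc (state_eq_merge_splitPath p ω t)

section Arrivals

lemma integrable_of_le_A {f : Slot sys.N → ℕ} (hf : Measurable f) (hle : ∀ x, f x ≤ x.A) (k t : ℕ) :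
    Integrable (fun ω : sys.Path => (f (ω t) : ℝ) ^ k) sys.P := by
  have h : Integrable (fun x : Slot sys.N => (f x : ℝ) ^ k) sys.slotLaw := by
    refine (integrable_const (1 : ℝ)).mono'
      ((measurable_from_nat.comp hf).pow_const k).aestronglyMeasurable
      (sys.ae_A_le_one.mono fun x hx => ?_)
    rw [Real.norm_of_nonneg (by positivity)]
    exact pow_le_one₀ (by positivity) (by exact_mod_cast (hle x).trans hx)
  exact (sys.measurePreserving_eval t).integrable_comp_of_integrable h

lemma arrLoc_le_A (p : I) (x : Slot sys.N) : x.arrLoc p ≤ x.A := by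
  have := x.arrLoc_add_arrMec p
  omega

lemma arrMec_le_A (p : I) (x : Slot sys.N) : x.arrMec p ≤ x.A := by
  have := x.arrLoc_add_arrMec p
  omega

lemma integral_arrLoc (p : I) (t : ℕ) :
    ∫ ω : sys.Path, ((ω t).arrLoc p : ℝ) ∂sys.P = sys.lam * p := by
  rw [sys.integral_comp_eval (f := fun x => (x.arrLoc p : ℝ))
    (measurable_from_nat.comp (Slot.measurable_arrLoc p)) t]
  have h1 : ∀ x : Slot sys.N, (x.arrLoc p : ℝ) =
      (x.A : ℝ) * (Set.Iic p).indicator (fun _ => (1 : ℝ)) x.seed := fun x => by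
    unfold Slot.arrLoc
    by_cases h : x.seed ≤ p <;> simp [h]
  simp only [h1]
  have h2 := sys.indepFun_seed_A.integral_fun_comp_mul_comp (f := fun k : ℕ => (k : ℝ))
    (g := (Set.Iic p).indicator (fun _ => (1 : ℝ))) Slot.measurable_A.aemeasurable
    Slot.measurable_seed.aemeasurable measurable_from_nat.aestronglyMeasurable
    (measurable_const.indicator measurableSet_Iic).aestronglyMeasurable
  rw [h2, integral_A]
  congr 1
  have h3 : ∀ x : Slot sys.N, (Set.Iic p).indicator (fun _ => (1 : ℝ)) x.seed =
      (Slot.seed ⁻¹' Set.Iic p).indicator 1 x := fun x => rfl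
  simp only [h3]
  rw [integral_indicator_one (Slot.measurable_seed measurableSet_Iic), measureReal_def,
    slotLaw_seed _ measurableSet_Iic, unitInterval.volume_Iic, ENNReal.toReal_ofReal p.2.1]

lemma integral_arrMec (p : I) (t : ℕ) :
    ∫ ω : sys.Path, ((ω t).arrMec p : ℝ) ∂sys.P = sys.lam * (1 - p) := by
  have h1 : ∀ ω : sys.Path, ((ω t).arrMec p : ℝ) = (ω t).A - (ω t).arrLoc p := fun ω => by
    have := (ω t).arrLoc_add_arrMec p
    rw [eq_sub_iff_add_eq, ← this]
    push_cast
    ring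
  have i1 := integrable_of_le_A (sys := sys) (Slot.measurable_arrLoc p) (arrLoc_le_A p) 1 t
  simp only [pow_one] at i1
  simp only [h1]
  rw [integral_sub (sys.integrable_comp_A (f := fun k => (k : ℝ)) t) i1, integral_arrival,
    integral_arrLoc]
  ring

end Arrivals

lemma sum_le_sum_of_queue {q u a : ℕ → ℕ} (hq : q 0 = 0) (hs : ∀ t, q (t + 1) = q t - u t + a t)
    (hu : ∀ t, u t ≤ q t) (T : ℕ) :
    ∑ t ∈ Finset.range T, u t ≤ ∑ t ∈ Finset.range T, a t := by
  have h : q T + ∑ t ∈ Finset.range T, u t = ∑ t ∈ Finset.range T, a t := by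
    induction T with
    | zero => simpa using hq
    | succ T ih =>
      have := hu T
      rw [Finset.sum_range_succ, Finset.sum_range_succ, ← ih, hs]
      omega
  omega

section SplitPolicy

variable (p : I)

lemma splitPolicy_ul (t : ℕ) (ω : sys.Path) : (sys.splitPolicy p).ul t ω =
    if (sys.splitPolicy p).Sl t ω = 0 ∧ 0 < (sys.splitPath p ω t).1 then 1 else 0 := by
  rw [splitPolicy_Sl]
  exact SplitState.ul_decision _

lemma splitPolicy_uc (t : ℕ) (ω : sys.Path) : (sys.splitPolicy p).uc t ω =
    if (sys.splitPolicy p).Sc t ω = 0 ∧ 0 < (sys.splitPath p ω t).2.1 then 1 else 0 := by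
  rw [splitPolicy_Sc]
  exact SplitState.uc_decision _

/-- The local queue is fed by thinned arrivals of rate `λp`. These depend on the current seed, hence
are independent of `past t` but not in general of `info t`; this is why the stability lemma has two
filtrations. -/
lemma exists_sum_integral_splitPath_loc_le (h : sys.lam * p * sys.meanNl < 1) :
    ∃ C : ℝ, ∀ T : ℕ,
      ∑ t ∈ Finset.range T, ∫ ω, ((sys.splitPath p ω t).1 : ℝ) ∂sys.P ≤ C * T := by
  have i1 := integrable_of_le_A (sys := sys) (Slot.measurable_arrLoc p) (arrLoc_le_A p) 1
  simp only [pow_one] at i1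
  exact (sys.splitPolicy p).server_loc.exists_sum_integral_queue_le (ℱ := sys.past)
    (a := fun t ω => (ω t).arrLoc p) (r₂ := ∫ x : Slot sys.N, (x.arrLoc p : ℝ) ^ 2 ∂sys.slotLaw)
    (by linarith [sys.one_le_meanNl]) sys.past_le_info (fun _ => rfl) (fun _ _ => rfl)
    (splitPolicy_ul p) (fun t => measurable_fst.comp (measurable_splitPath p t))
    (sys.splitPolicy p).measurable_Sl (fun t => indep_past_comap (Slot.measurable_arrLoc p) t) i1
    (integrable_of_le_A (Slot.measurable_arrLoc p) (arrLoc_le_A p) 2) (integral_arrLoc p)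
    (fun t => sys.integral_comp_eval (f := fun x => (x.arrLoc p : ℝ) ^ 2)
      ((measurable_from_nat.comp (Slot.measurable_arrLoc p)).pow_const 2) t)
    (fun t => (measurePreserving_pick ((sys.splitPolicy p).measurable_comp_act Decision.ul2
      t)).quasiMeasurePreserving.ae sys.ae_one_le_Nl) h

lemma exists_sum_integral_splitPath_mec_le (h : sys.lam * (1 - p) * sys.meanNc < 1) :
    ∃ C : ℝ, ∀ T : ℕ,
      ∑ t ∈ Finset.range T, ∫ ω, ((sys.splitPath p ω t).2.1 : ℝ) ∂sys.P ≤ C * T := by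
  have i1 := integrable_of_le_A (sys := sys) (Slot.measurable_arrMec p) (arrMec_le_A p) 1
  simp only [pow_one] at i1
  exact (sys.splitPolicy p).server_mec.exists_sum_integral_queue_le (ℱ := sys.past)
    (a := fun t ω => (ω t).arrMec p) (r₂ := ∫ x : Slot sys.N, (x.arrMec p : ℝ) ^ 2 ∂sys.slotLaw)
    (by linarith [sys.one_le_meanNc]) sys.past_le_info (fun _ => rfl) (fun _ _ => rfl)
    (splitPolicy_uc p)
    (fun t => (measurable_fst.comp measurable_snd).comp (measurable_splitPath p t))
    (sys.splitPolicy p).measurable_Sc (fun t => indep_past_comap (Slot.measurable_arrMec p) t) i1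
    (integrable_of_le_A (Slot.measurable_arrMec p) (arrMec_le_A p) 2) (integral_arrMec p)
    (fun t => sys.integral_comp_eval (f := fun x => (x.arrMec p : ℝ) ^ 2)
      ((measurable_from_nat.comp (Slot.measurable_arrMec p)).pow_const 2) t)
    (fun t => (measurePreserving_pick ((sys.splitPolicy p).measurable_comp_act Decision.uc2
      t)).quasiMeasurePreserving.ae sys.ae_one_le_Nc) h

/-- Starts from a queue that begins empty never outnumber the arrivals to it, path by path. -/
lemma splitPolicy_startsLoc_le (T : ℕ) :
    (sys.splitPolicy p).startsLoc T ≤ sys.lam * p * T := by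
  have i1 := integrable_of_le_A (sys := sys) (Slot.measurable_arrLoc p) (arrLoc_le_A p) 1
  simp only [pow_one] at i1
  have iu := (sys.splitPolicy p).server_loc.integrable_u
  rw [Policy.startsLoc, ← integral_finsetSum _ fun t _ => iu t]
  calc _ ≤ ∫ ω, ∑ t ∈ Finset.range T, ((ω t).arrLoc p : ℝ) ∂sys.P := by
        refine integral_mono (integrable_finsetSum _ fun t _ => iu t)
          (integrable_finsetSum _ fun t _ => i1 t) fun ω => ?_
        exact_mod_cast sum_le_sum_of_queue (q := fun t => (sys.splitPath p ω t).1) rfl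
          (fun t => rfl) (fun t => SplitState.ul_decision_le _) T
    _ = sys.lam * p * T := by
        rw [integral_finsetSum _ fun t _ => i1 t]
        simp only [integral_arrLoc, Finset.sum_const, Finset.card_range, nsmul_eq_mul]
        ring

lemma splitPolicy_startsMec_le (T : ℕ) :
    (sys.splitPolicy p).startsMec T ≤ sys.lam * (1 - p) * T := by
  have i1 := integrable_of_le_A (sys := sys) (Slot.measurable_arrMec p) (arrMec_le_A p) 1
  simp only [pow_one] at i1
  have iu := (sys.splitPolicy p).server_mec.integrable_u
  rw [Policy.startsMec, ← integral_finsetSum _ fun t _ => iu t]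
  calc _ ≤ ∫ ω, ∑ t ∈ Finset.range T, ((ω t).arrMec p : ℝ) ∂sys.P := by
        refine integral_mono (integrable_finsetSum _ fun t _ => iu t)
          (integrable_finsetSum _ fun t _ => i1 t) fun ω => ?_
        exact_mod_cast sum_le_sum_of_queue (q := fun t => (sys.splitPath p ω t).2.1) rfl
          (fun t => rfl) (fun t => SplitState.uc_decision_le _) T
    _ = sys.lam * (1 - p) * T := by
        rw [integral_finsetSum _ fun t _ => i1 t]
        simp only [integral_arrMec, Finset.sum_const, Finset.card_range, nsmul_eq_mul]
        ring

lemma splitPolicy_mem_feasible (hl : sys.lam * p * sys.meanNl < 1)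
    (hc : sys.lam * (1 - p) * sys.meanNc < 1) : sys.splitPolicy p ∈ sys.feasible := by
  obtain ⟨C, hC⟩ := exists_sum_integral_splitPath_loc_le p hl
  obtain ⟨C', hC'⟩ := exists_sum_integral_splitPath_mec_le p hc
  refine lt_of_le_of_lt (b := ENNReal.ofReal (C + C')) ?_ ENNReal.ofReal_lt_top
  refine limsup_le_of_le (h := ?_)
  filter_upwards [eventually_gt_atTop 0] with T hT
  have hT0 : (0 : ℝ) < T := by exact_mod_cast hT
  rw [Policy.lintegral_sum_Q, ← ENNReal.ofReal_natCast, ← ENNReal.ofReal_div_of_pos hT0]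
  refine ENNReal.ofReal_le_ofReal ?_
  rw [div_le_iff₀ hT0]
  have hQ : ∀ t, ∫ ω, ((sys.splitPolicy p).Q t ω : ℝ) ∂sys.P =
      ∫ ω, ((sys.splitPath p ω t).1 : ℝ) ∂sys.P +
        ∫ ω, ((sys.splitPath p ω t).2.1 : ℝ) ∂sys.P := fun t => by
    have hle : ∀ f : SplitState → ℕ, (∀ s, f s ≤ s.1 + s.2.1) →
        Integrable (fun ω => (f (sys.splitPath p ω t) : ℝ)) sys.P := fun f hf => by
      refine ((sys.splitPolicy p).integrable_Q t).mono' ?_ (ae_of_all _ fun ω => ?_)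
      · exact (measurable_from_nat.comp (Measurable.of_discrete.comp
          ((measurable_splitPath p t).mono (sys.past_le t) le_rfl))).aestronglyMeasurable
      · rw [Real.norm_of_nonneg (by positivity), splitPolicy_Q]
        exact_mod_cast hf _
    rw [← integral_add (hle (fun s => s.1) fun s => by omega)
      (hle (fun s => s.2.1) fun s => by omega)]
    simp only [splitPolicy_Q, Nat.cast_add]
  simp only [hQ, Finset.sum_add_distrib]
  linarith [hC T, hC' T]

lemma splitPolicy_avgData_le : (sys.splitPolicy p).avgData ≤
    ENNReal.ofReal (p * sys.meanDlt + (1 - p) * sys.meanDct) := by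
  have hDl := sys.meanDlt_nonneg
  have hDc := sys.meanDct_nonneg
  have hp : (0 : ℝ) ≤ p := p.2.1
  have hp' : (0 : ℝ) ≤ 1 - p := sub_nonneg.2 p.2.2
  refine Policy.avgData_le (by positivity) fun δ hδ => ⟨0, fun T => ?_⟩
  have h1 := mul_le_mul_of_nonneg_right (splitPolicy_startsLoc_le (sys := sys) p T) hDl
  have h2 := mul_le_mul_of_nonneg_right (splitPolicy_startsMec_le (sys := sys) p T) hDc
  have h3 : 0 ≤ δ * T := by positivity
  nlinarith

end SplitPolicy

/-- A splitting probability under which the MEC server has load less than one and the mobile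
device has load at most one gives an upper bound for the optimal value. -/
lemma feasible_nonempty_and_optData_le {p : ℝ} (hp : 0 < p) (hp1 : p ≤ 1)
    (hl : sys.lam * p * sys.meanNl ≤ 1) (hc : sys.lam * (1 - p) * sys.meanNc < 1) :
    sys.feasible.Nonempty ∧
      sys.optData ≤ ENNReal.ofReal (p * sys.meanDlt + (1 - p) * sys.meanDct) := by
  have hlam := coe_lam_pos (sys := sys)
  have hNl : 0 < sys.meanNl := by linarith [sys.one_le_meanNl]
  have hDl := sys.meanDlt_nonneg
  have hDc := sys.meanDct_nonneg
  have hval : 0 ≤ p * sys.meanDlt + (1 - p) * sys.meanDct := by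
    have : 0 ≤ 1 - p := by linarith
    positivity
  -- The local load may equal one at `p`, so `p` is replaced by `p(1 - η)`. This makes it strictly
  -- less than one; for small `η`, continuity keeps the MEC load below one and the cost within `ε`.
  have key : ∀ ε : ℝ, 0 < ε → ∃ π ∈ sys.feasible,
      π.avgData ≤ ENNReal.ofReal (p * sys.meanDlt + (1 - p) * sys.meanDct + ε) := fun ε hε => by
    have e1 : ∀ᶠ η : ℝ in nhdsWithin 0 (Set.Ioi 0),
        sys.lam * (1 - p * (1 - η)) * sys.meanNc < 1 := by
      have : Continuous fun η : ℝ => sys.lam * (1 - p * (1 - η)) * sys.meanNc := by fun_prop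
      exact nhdsWithin_le_nhds ((this.tendsto 0).eventually_lt_const (by simpa using hc))
    have e2 : ∀ᶠ η : ℝ in nhdsWithin 0 (Set.Ioi 0), p * (1 - η) * sys.meanDlt +
        (1 - p * (1 - η)) * sys.meanDct < p * sys.meanDlt + (1 - p) * sys.meanDct + ε := by
      have : Continuous fun η : ℝ => p * (1 - η) * sys.meanDlt +
        (1 - p * (1 - η)) * sys.meanDct := by fun_prop
      exact nhdsWithin_le_nhds ((this.tendsto 0).eventually_lt_const (by simpa using hε))
    have e3 : ∀ᶠ η : ℝ in nhdsWithin 0 (Set.Ioi 0), η < 1 :=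
      nhdsWithin_le_nhds (eventually_lt_nhds one_pos)
    obtain ⟨η, h1, h2, h3, h4⟩ :=
      (e1.and (e2.and (e3.and eventually_mem_nhdsWithin))).exists
    have h4 : 0 < η := h4
    have hlt : p * (1 - η) < p := by nlinarith
    have hI : p * (1 - η) ∈ I :=
      ⟨mul_nonneg hp.le (by linarith), by linarith⟩
    refine ⟨sys.splitPolicy ⟨p * (1 - η), hI⟩, splitPolicy_mem_feasible _ ?_ h1,
      (splitPolicy_avgData_le _).trans (ENNReal.ofReal_le_ofReal h2.le)⟩
    refine lt_of_lt_of_le ?_ hl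
    have : (sys.lam : ℝ) * (p * (1 - η)) < sys.lam * p := mul_lt_mul_of_pos_left hlt hlam
    exact mul_lt_mul_of_pos_right this hNl
  refine ⟨(key 1 one_pos).imp fun π h => h.1, ?_⟩
  refine ENNReal.le_of_forall_pos_le_add fun ε hε _ => ?_
  obtain ⟨π, hπ, hle⟩ := key ε hε
  refine (iInf₂_le π hπ).trans (hle.trans (le_of_eq ?_))
  rw [ENNReal.ofReal_add hval ε.coe_nonneg, ENNReal.ofReal_coe_nnreal]

end System

end MEC

end

/-! ### The four regimes -/

theorem proposition1 (sys : MEC.System) :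
    ((sys.lam : ℝ) ≤ 1 / sys.meanNl →
      sys.feasible.Nonempty ∧ sys.optData = ENNReal.ofReal sys.meanDlt) ∧
    (1 / sys.meanNl < (sys.lam : ℝ) → (sys.lam : ℝ) < 1 / sys.meanNl + 1 / sys.meanNc →
      sys.feasible.Nonempty ∧
      sys.optData = ENNReal.ofReal
        (sys.meanDct - 1 / ((sys.lam : ℝ) * sys.meanNl) * (sys.meanDct - sys.meanDlt))) ∧
    ((sys.lam : ℝ) = 1 / sys.meanNl + 1 / sys.meanNc →
      (sys.feasible.Nonempty → sys.optData = ENNReal.ofReal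
        (sys.meanDct - 1 / ((sys.lam : ℝ) * sys.meanNl) * (sys.meanDct - sys.meanDlt))) ∧
      ((sys.lam : ℝ) < 1 → sys.feasible = ∅)) ∧
    (1 / sys.meanNl + 1 / sys.meanNc < (sys.lam : ℝ) → sys.feasible = ∅) := by
  have hlam := MEC.System.coe_lam_pos (sys := sys)
  have hNl : 0 < sys.meanNl := by linarith [sys.one_le_meanNl]
  have hNc : 0 < sys.meanNc := by linarith [sys.one_le_meanNc]
  refine ⟨fun h => ?_, fun h h' => ?_, fun h => ⟨fun hne => ?_, fun h1 => ?_⟩, fun h => ?_⟩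
  · rw [le_div_iff₀ hNl] at h
    -- Everything is sent to the mobile device: `p = 1`.
    obtain ⟨h1, h2⟩ := MEC.System.feasible_nonempty_and_optData_le (sys := sys) one_pos le_rfl
      (by simpa using h) (by simp)
    refine ⟨h1, le_antisymm (by simpa using h2) ?_⟩
    exact le_iInf₂ fun π hπ => MEC.System.Policy.meanDlt_le_avgData hπ
  · have hp : (sys.lam : ℝ) * (1 / (sys.lam * sys.meanNl)) = 1 / sys.meanNl := by field_simp
    -- This `p` gives the mobile device load exactly one; the rest, at rate `λ - 1/meanNl`, is less
    -- than the MEC server can handle.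
    obtain ⟨h1, h2⟩ := MEC.System.feasible_nonempty_and_optData_le (sys := sys)
      (p := 1 / (sys.lam * sys.meanNl)) (by positivity)
      (by rw [div_lt_iff₀ hNl] at h; rw [div_le_one (by positivity)]; exact h.le)
      (by rw [hp, one_div_mul_cancel hNl.ne'])
      (by
        rw [mul_sub, hp, mul_one, ← lt_div_iff₀ hNc]
        linarith)
    refine ⟨h1, le_antisymm (h2.trans (le_of_eq ?_)) ?_⟩
    · congr 1
      ring
    · exact le_iInf₂ fun π hπ => MEC.System.Policy.mixed_le_avgData hπ
  -- Upper and lower bound hold for every feasible policy here, so any one of them attains the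
  -- optimum.
  · refine le_antisymm ?_ (le_iInf₂ fun π hπ => MEC.System.Policy.mixed_le_avgData hπ)
    obtain ⟨π, hπ⟩ := hne
    exact (iInf₂_le π hπ).trans (MEC.System.Policy.avgData_le_of_critical h)
  · exact MEC.System.feasible_eq_empty_of_critical h h1
  · exact MEC.System.feasible_eq_empty_of_lt h
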